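/- Let $P$ be a simple polygon in the Euclidean plane with vertices $v_1,\dots,v_n$ ($n\ge 3$) in boundary order. Two points of $P$ are mutually visible if the segment between them does not meet the exterior of $P$, and the visibility graph $G$ of $P$ has the vertices of $P$ as its vertices, two distinct ones being adjacent iff they are mutually visible. A chord (internal edge) of $P$ is an edge of $G$ that is not a boundary edge of $P$. A chord $uv$ crosses a chord $xy$ if the two segments meet and $u,v$ lie on different sides of $xy$, i.e. one in each of the two open boundary chains between $x$ and $y$. A bottleneck pair of $G$ is a pair of adjacent vertices whose removal disconnects $G$. $P$ is reduced if each of its chords is crossed by another chord. The reduced subpolygons of $P$ are the reduced polygons obtained from $P$ by repeatedly dividing the current polygon along a chord of it that is crossed by none of its chords. The reduced subgraphs of $G$ are the graphs obtained as follows: start with $G$; as long as a bottleneck pair $x,y$ of $G$ lies in the current piece and disconnects it, remove $x,y$ from the piece and replace it by the pieces induced on $C\cup\{x,y\}$, one for each connected component $C$ that is left (each component receives its own copy of $x,y$); the pieces that no bottleneck pair of $G$ disconnects are the reduced subgraphs. Then the following hold. 1. A pair $\{x,y\}$ of vertices is a bottleneck pair of $G$ if and only if $xy$ is a chord of $P$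 that no chord of $P$ crosses. 2. If moreover no chord of $P$ passes through a third vertex of $P$ (for instance if no three vertices are collinear), then $\{x,y\}$ is a bottleneck pair of $G$ if and only if $xy$ is a chord of $P$ and the open segment $xy$ is disjoint from the open segment $uv$ for every other chord $uv$ of $P$. 3. Every reduced subpolygon of $P$ is a simple polygon; each reduced subgraph of $G$ is the visibility graph of some reduced subpolygon of $P$ (with the same vertices), and each reduced subpolygon of $P$ has a reduced subgraph of $G$ as its visibility graph. -/

import Mathlib

/-- The Euclidean plane. -/
abbrev Plane : Type := EuclideanSpace ℝ (Fin 2)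

namespace Polygon

variable {n : ℕ}

/-- A simple polygon: at least three vertices, pairwise distinct; two consecutive edges meet
exactly in their common vertex, and any two other distinct edges are disjoint.
The successor of the vertex `i` on the boundary is `finRotate n i`. -/
structure IsSimple (P : Polygon Plane n) : Prop where
  three_le : 3 ≤ n
  injective : Function.Injective P.vertices
  consecutive : ∀ i : Fin n,
    P.edgeSet ℝ i ∩ P.edgeSet ℝ (finRotate n i) = {P (finRotate n i)}
  nonconsecutive : ∀ i j : Fin n, j ≠ i → j ≠ finRotate n i → i ≠ finRotate n j →
    Disjoint (P.edgeSet ℝ i) (P.edgeSet ℝ j)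

/-- The exterior of a polygon: the points off the boundary whose connected component in the
complement of the boundary is unbounded. -/
def exterior (P : Polygon Plane n) : Set Plane :=
  {z | z ∈ (P.boundary ℝ)ᶜ ∧
    ¬ Bornology.IsBounded (connectedComponentIn (P.boundary ℝ)ᶜ z)}

/-- Two points are mutually visible if the segment between them misses the exterior. -/
def MutuallyVisible (P : Polygon Plane n) (p q : Plane) : Prop :=
  Disjoint (segment ℝ p q) P.exterior

/-- The visibility graph: two distinct vertices are adjacent iff they are mutually visible. -/
def visibilityGraph (P : Polygon Plane n) : SimpleGraph (Fin n) where
  Adj i j := i ≠ j ∧ P.MutuallyVisible (P i) (P j)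
  symm := ⟨fun i j h => ⟨h.1.symm, by
    have h2 := h.2
    unfold MutuallyVisible at h2 ⊢
    rwa [segment_symm]⟩⟩
  loopless := ⟨fun _ h => h.1 rfl⟩

/-- An internal edge (chord): a visibility edge that is not a boundary edge of the polygon. -/
def IsChord (P : Polygon Plane n) (x y : Fin n) : Prop :=
  P.visibilityGraph.Adj x y ∧ y ≠ finRotate n x ∧ x ≠ finRotate n y

/-- The chord `uv` crosses the chord `xy`: the segments meet, and `u`, `v` lie on different
sides of `xy`, that is, one in each of the two open boundary chains between `x` and `y`. -/
def Crosses (P : Polygon Plane n) (u v x y : Fin n) : Prop :=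
  (segment ℝ (P u) (P v) ∩ segment ℝ (P x) (P y)).Nonempty ∧
    ((sbtw x u y ∧ sbtw y v x) ∨ (sbtw x v y ∧ sbtw y u x))

/-- A chord that is crossed by no chord. -/
def IsUncrossedChord (P : Polygon Plane n) (x y : Fin n) : Prop :=
  P.IsChord x y ∧ ∀ u v : Fin n, P.IsChord u v → ¬ P.Crosses u v x y

/-- A polygon is reduced if each of its chords is crossed by another chord. -/
def IsReduced (P : Polygon Plane n) : Prop :=
  ∀ x y : Fin n, P.IsChord x y → ∃ u v : Fin n, P.IsChord u v ∧ P.Crosses u v x y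

/-- The polygon whose vertices are the vertices of `P` with index in `S`, in the order in
which they occur on the boundary of `P`. -/
def sub (P : Polygon Plane n) (S : Finset (Fin n)) : Polygon Plane S.card :=
  ⟨fun a => P (S.orderEmbOfFin rfl a)⟩

/-- The vertex sets of the subpolygons which arise from `P` by repeatedly dividing along an
uncrossed chord `ab` of the current subpolygon: the part that is kept has as its vertices
`a`, `b` and the vertices between `a` and `b` in the cyclic order. (The other part is obtained
by interchanging `a` and `b`.) -/
inductive IsSubpolygon (P : Polygon Plane n) : Finset (Fin n) → Prop
  | whole : IsSubpolygon P Finset.univ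
  | divide (S T : Finset (Fin n)) (a b : Fin S.card) :
      IsSubpolygon P S → (P.sub S).IsUncrossedChord a b →
      (∀ w : Fin n,
        w ∈ T ↔ w ∈ S ∧ btw (S.orderEmbOfFin rfl a) w (S.orderEmbOfFin rfl b)) →
      IsSubpolygon P T

/-- The reduced subpolygons of `P` (given by their vertex sets): the subpolygons that arise by
dividing along uncrossed chords and that are reduced. -/
def IsReducedSubpolygon (P : Polygon Plane n) (S : Finset (Fin n)) : Prop :=
  P.IsSubpolygon S ∧ (P.sub S).IsReduced

/-- The subgraph `H` of the visibility graph of `P` is the visibility graph of the polygon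
`P.sub S`, the vertices of `P.sub S` being identified with those of `P`. -/
def IsVisibilityGraphOfSub (P : Polygon Plane n) (S : Finset (Fin n))
    (H : P.visibilityGraph.Subgraph) : Prop :=
  H.verts = (S : Set (Fin n)) ∧
    ∀ a b : Fin S.card, H.Adj (S.orderEmbOfFin rfl a) (S.orderEmbOfFin rfl b) ↔
      (P.sub S).visibilityGraph.Adj a b

end Polygon

namespace SimpleGraph

variable {V : Type*}

/-- A bottleneck pair: two adjacent vertices whose removal disconnects the graph. -/
def IsBottleneckPair (G : SimpleGraph V) (x y : V) : Prop :=
  G.Adj x y ∧ ¬ (G.induce ({x, y}ᶜ : Set V)).Preconnected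

/-- The vertex sets obtained from `G` by successively cutting at bottleneck pairs `x, y` of `G`:
`x` and `y` are removed from the current piece, and each connected component that is left
receives a copy of `x` and `y` back. -/
inductive IsPiece (G : SimpleGraph V) : Set V → Prop
  | whole : IsPiece G Set.univ
  | cut (S : Set V) (x y : V) (C : (G.induce (S \ {x, y})).ConnectedComponent) :
      IsPiece G S → G.IsBottleneckPair x y → x ∈ S → y ∈ S →
      IsPiece G ((Subtype.val '' C.supp) ∪ {x, y})

/-- A reduced subgraph of `G`: what is left when this has been done with every bottleneck pair,
that is, the subgraph of `G` induced on a piece which no bottleneck pair of `G` disconnects. -/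
def IsReducedSubgraph (G : SimpleGraph V) (H : G.Subgraph) : Prop :=
  ∃ S : Set V, G.IsPiece S ∧
    (∀ x y : V, G.IsBottleneckPair x y → x ∈ S → y ∈ S →
      (G.induce (S \ {x, y})).Preconnected) ∧
    H = (⊤ : G.Subgraph).induce S

end SimpleGraph

/-!
Angles seen from a point off the boundary add up to an integral winding number, which jumps by one
across every edge; near its boundary a simple polygon has only two sides, so the winding number of a
point is `0` or `±1`, and it is nonzero exactly inside. Winding numbers are additive when a polygon
is divided along a diagonal, so the region splits into the regions of the two parts, and a chord
between the two chains of a diagonal meets the diagonal. An induction along diagonals shows that a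
pair of vertices which no diagonal separates is an edge or a diagonal itself. Hence a chord `xy` is
uncrossed iff no visibility edge joins the two open chains between `x` and `y`. As each open chain
is connected through boundary edges, this says that removing `x` and `y` disconnects the visibility
graph. Dividing along an uncrossed chord changes neither the visibility between the remaining
vertices nor which of their chords are uncrossed, so the subpolygons and the pieces are cut along
the same pairs.
-/

namespace SimplePolygon

open Set Filter Topology Polygon

section Segment

variable {E : Type*} [AddCommGroup E] [Module ℝ E]

lemma eq_or_eq_or_mem_openSegment_of_mem_segment {p q z : E} (hz : z ∈ segment ℝ p q) :
    z = p ∨ z = q ∨ z ∈ openSegment ℝ p q := by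
  by_cases hp : z = p
  · exact Or.inl hp
  by_cases hq : z = q
  · exact Or.inr (Or.inl hq)
  exact Or.inr (Or.inr (mem_openSegment_of_ne_left_right (Ne.symm hp) (Ne.symm hq) hz))

lemma mem_openSegment_iff_exists_add_smul {p q z : E} :
    z ∈ openSegment ℝ p q ↔ ∃ t ∈ Ioo (0 : ℝ) 1, z = p + t • (q - p) := by
  rw [openSegment_eq_image']
  exact exists_congr fun t => and_congr_right fun _ => eq_comm

lemma add_smul_notMem_segment {p q z d : E} (hd : LinearIndependent ℝ ![q - p, d])
    (hz : z ∈ segment ℝ p q) {t : ℝ} (ht : t ≠ 0) : z + t • d ∉ segment ℝ p q := by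
  rw [segment_eq_image'] at hz ⊢
  rintro ⟨s', -, hs'⟩
  obtain ⟨s, -, rfl⟩ := hz
  refine ht (LinearIndependent.pair_iff.1 hd (s - s') t ?_).2
  calc (s - s') • (q - p) + t • d
      = p + s • (q - p) + t • d - (p + s' • (q - p)) := by module
    _ = 0 := sub_eq_zero.2 hs'.symm

variable [TopologicalSpace E] [IsTopologicalAddGroup E] [ContinuousSMul ℝ E]

lemma isCompact_segment (p q : E) : IsCompact (segment ℝ p q) := by
  rw [segment_eq_image]
  exact isCompact_Icc.image (by fun_prop)

lemma tendsto_add_smul_nhds_zero (z d : E) :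
    Tendsto (fun t : ℝ => z + t • d) (𝓝 0) (𝓝 z) := by
  have h : Continuous fun t : ℝ => z + t • d := by fun_prop
  simpa only [zero_smul, add_zero] using h.tendsto 0

end Segment

/-! ### Winding numbers -/

section Angle

variable {p q z d : Plane}

/-- The identification of the plane with the complex numbers, through which angles are measured. -/
noncomputable def toComplex : Plane ≃ₗᵢ[ℝ] ℂ := Complex.orthonormalBasisOneI.repr.symm

/-- The signed angle in `(-π, π]` under which the segment from `p` to `q` is seen from `z`; it is
the contribution of the edge `pq` to the winding number around `z`. -/
noncomputable def visualAngle (p q z : Plane) : ℝ :=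
  Complex.arg (toComplex (q - z) / toComplex (p - z))

lemma toComplex_ne_zero : toComplex z ≠ 0 ↔ z ≠ 0 := map_ne_zero_iff toComplex toComplex.injective

lemma toComplex_sub_ne_zero (h : p ≠ z) : toComplex (p - z) ≠ 0 :=
  toComplex_ne_zero.2 (sub_ne_zero.2 h)

lemma im_toComplex_div_ne_zero {e : Plane} (h : LinearIndependent ℝ ![e, d]) :
    (toComplex d / toComplex e).im ≠ 0 := by
  intro him
  have he₀ : e ≠ 0 := h.ne_zero 0
  have he : toComplex e ≠ 0 := toComplex_ne_zero.2 he₀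
  refine (LinearIndependent.pair_iff' he₀).1 h (toComplex d / toComplex e).re
    (toComplex.injective ?_)
  have hreal : (((toComplex d / toComplex e).re : ℝ) : ℂ) = toComplex d / toComplex e :=
    Complex.ext (Complex.ofReal_re _) (by rw [Complex.ofReal_im, him])
  rw [map_smul, Complex.real_smul, hreal, div_mul_cancel₀ _ he]

open scoped ComplexOrder in
lemma toComplex_div_mem_slitPlane (hz : z ∉ segment ℝ p q) :
    toComplex (q - z) / toComplex (p - z) ∈ Complex.slitPlane := by
  rw [Complex.mem_slitPlane_iff_not_le_zero, ← neg_nonneg, ← Complex.arg_eq_zero_iff_zero_le,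
    ← div_neg, ← map_neg, neg_sub, ← Complex.sameRay_iff_arg_div_eq_zero]
  intro h
  refine hz (mem_segment_iff_sameRay.2 (SameRay.symm ?_))
  exact (SameRay.sameRay_map_iff (e := toComplex.toLinearEquiv)).1 h

lemma visualAngle_add_swap (hz : z ∉ segment ℝ p q) :
    visualAngle p q z + visualAngle q p z = 0 := by
  have hpi := (Complex.mem_slitPlane_iff_arg.1 (toComplex_div_mem_slitPlane hz)).1
  unfold visualAngle
  rw [← inv_div (toComplex (q - z)), Complex.arg_inv, if_neg hpi, add_neg_cancel]

lemma continuousAt_visualAngle (hz : z ∉ segment ℝ p q) : ContinuousAt (visualAngle p q) z := by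
  have hp : p ≠ z := by rintro rfl; exact hz (left_mem_segment _ _ _)
  refine (Complex.continuousAt_arg (toComplex_div_mem_slitPlane hz)).comp
    (f := fun y => toComplex (q - y) / toComplex (p - y)) ?_
  exact ContinuousAt.div (by fun_prop) (by fun_prop) (toComplex_sub_ne_zero hp)

lemma tendsto_visualAngle_cobounded (p q : Plane) :
    Tendsto (visualAngle p q) (Bornology.cobounded Plane) (𝓝 0) := by
  have hbase : Tendsto (fun z => toComplex (p - z)) (Bornology.cobounded Plane)
      (Bornology.cobounded ℂ) := by
    refine toComplex.antilipschitz.tendsto_cobounded.comp ?_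
    exact (IsometryEquiv.subLeft p).isometry.antilipschitz.tendsto_cobounded
  have hratio : Tendsto (fun z => 1 + toComplex (q - p) * (toComplex (p - z))⁻¹)
      (Bornology.cobounded Plane) (𝓝 1) := by
    simpa using (((tendsto_inv₀_cobounded (α := ℂ)).comp hbase).const_mul
      (toComplex (q - p))).const_add 1
  have harg := (Complex.continuousAt_arg (x := 1) (by simp)).tendsto.comp hratio
  rw [Complex.arg_one] at harg
  refine harg.congr' ?_
  filter_upwards [hbase.eventually (Bornology.isBounded_singleton (x := (0 : ℂ)))] with z hz
  have hz : toComplex (p - z) ≠ 0 := hz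
  have hsplit : toComplex (q - z) = toComplex (p - z) + toComplex (q - p) := by
    rw [← map_add]; congr 1; abel
  rw [visualAngle, hsplit, add_div, div_self hz, div_eq_mul_inv, Function.comp_apply]

/-- In the coordinate `(z - x) / (q - p)` centred at the point `x = p + s (q - p)` of the edge, a
displacement by `t d` is a displacement by `t c`. -/
lemma visualAngle_add_smul (hpq : p ≠ q) (s t : ℝ) :
    visualAngle p q (p + s • (q - p) + t • d) =
      Complex.arg ((1 - s - t * (toComplex d / toComplex (q - p))) /
        (-s - t * (toComplex d / toComplex (q - p)))) := by
  have he : toComplex (q - p) ≠ 0 := toComplex_sub_ne_zero hpq.symm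
  have hq : toComplex (q - (p + s • (q - p) + t • d)) =
      toComplex (q - p) * (1 - s - t * (toComplex d / toComplex (q - p))) := by
    rw [show q - (p + s • (q - p) + t • d) = (1 - s) • (q - p) - t • d by module, map_sub,
      map_smul, map_smul, Complex.real_smul, Complex.real_smul]
    field_simp
    push_cast
    ring
  have hp : toComplex (p - (p + s • (q - p) + t • d)) =
      toComplex (q - p) * (-s - t * (toComplex d / toComplex (q - p))) := by
    rw [show p - (p + s • (q - p) + t • d) = (-s) • (q - p) - t • d by module, map_sub,
      map_smul, map_smul, Complex.real_smul, Complex.real_smul]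
    field_simp
    push_cast
    ring
  rw [visualAngle, hq, hp, mul_div_mul_left _ _ he]

lemma tendsto_arg_div_of_im_pos {c : ℂ} (hc : 0 < c.im) {s : ℝ} (hs : s ∈ Ioo (0 : ℝ) 1) :
    Tendsto (fun t : ℝ => Complex.arg ((1 - s - t * c) / (-s - t * c))) (𝓝[>] 0)
        (𝓝 Real.pi) ∧
      Tendsto (fun t : ℝ => Complex.arg ((1 - s - t * c) / (-s - t * c))) (𝓝[<] 0)
        (𝓝 (-Real.pi)) := by
  set w : ℝ → ℂ := fun t => (1 - s - t * c) / (-s - t * c) with hw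
  have hs0 : (-(s : ℂ)) ≠ 0 := by simpa using hs.1.ne'
  have hw0 : w 0 = ((-((1 - s) / s) : ℝ) : ℂ) := by
    simp only [hw, Complex.ofReal_zero, zero_mul, sub_zero]
    push_cast
    rw [div_neg]
  have hre : (w 0).re < 0 := by
    rw [hw0, Complex.ofReal_re, neg_lt_zero]
    exact div_pos (sub_pos.2 hs.2) hs.1
  have him : (w 0).im = 0 := by rw [hw0, Complex.ofReal_im]
  have hcont : Tendsto w (𝓝 0) (𝓝 (w 0)) := by
    refine ContinuousAt.div (by fun_prop) (by fun_prop) ?_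
    simpa using hs0
  have him_eq : ∀ t, (w t).im = t * c.im / Complex.normSq (-s - t * c) := fun t => by
    simp only [hw, Complex.div_im, Complex.sub_re, Complex.sub_im, Complex.neg_re, Complex.neg_im,
      Complex.ofReal_re, Complex.ofReal_im, Complex.one_re, Complex.one_im, Complex.re_ofReal_mul,
      Complex.im_ofReal_mul, div_sub_div_same]
    ring
  have hden : ∀ t : ℝ, t ≠ 0 → 0 < Complex.normSq (-s - t * c) := fun t ht => by
    refine Complex.normSq_pos.2 fun h => ht ?_
    have := congrArg Complex.im h
    simpa [hc.ne'] using this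
  constructor
  · refine (Complex.tendsto_arg_nhdsWithin_im_nonneg_of_re_neg_of_im_zero hre him).comp
      (tendsto_nhdsWithin_iff.2 ⟨hcont.mono_left nhdsWithin_le_nhds, ?_⟩)
    filter_upwards [self_mem_nhdsWithin] with t (ht : 0 < t)
    exact (him_eq t).ge.trans' (div_pos (mul_pos ht hc) (hden t ht.ne')).le
  · refine (Complex.tendsto_arg_nhdsWithin_im_neg_of_re_neg_of_im_zero hre him).comp
      (tendsto_nhdsWithin_iff.2 ⟨hcont.mono_left nhdsWithin_le_nhds, ?_⟩)
    filter_upwards [self_mem_nhdsWithin] with t (ht : t < 0)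
    exact (him_eq t).trans_lt <| div_neg_of_neg_of_pos (mul_neg_of_neg_of_pos ht hc) (hden t ht.ne)

lemma exists_tendsto_visualAngle_sub (hd : LinearIndependent ℝ ![q - p, d])
    (hz : z ∈ openSegment ℝ p q) :
    ∃ a, |a| = 2 * Real.pi ∧
      Tendsto (fun t : ℝ => visualAngle p q (z + t • d) - visualAngle p q (z + (-t) • d))
        (𝓝[>] 0) (𝓝 a) := by
  have hpq : p ≠ q := (sub_ne_zero.1 (hd.ne_zero 0)).symm
  obtain ⟨s, hs, rfl⟩ := mem_openSegment_iff_exists_add_smul.1 hz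
  have hneg : Tendsto (fun t : ℝ => -t) (𝓝[>] 0) (𝓝[<] 0) := by
    simpa using tendsto_neg_nhdsGT (a := (0 : ℝ))
  rcases (im_toComplex_div_ne_zero hd).lt_or_gt with him | him
  · have him' : 0 < (toComplex (-d) / toComplex (q - p)).im := by
      rw [map_neg, neg_div, Complex.neg_im]; exact neg_pos.2 him
    obtain ⟨hright, hleft⟩ := tendsto_arg_div_of_im_pos him' hs
    simp_rw [← visualAngle_add_smul hpq, smul_neg, ← neg_smul] at hright hleft
    refine ⟨-Real.pi - Real.pi, ?_, ?_⟩
    · rw [← neg_add', abs_neg, abs_of_pos (by positivity), two_mul]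
    · simpa only [Function.comp_def, neg_neg] using (hleft.comp hneg).sub hright
  · obtain ⟨hright, hleft⟩ := tendsto_arg_div_of_im_pos him hs
    simp_rw [← visualAngle_add_smul hpq] at hright hleft
    refine ⟨Real.pi - -Real.pi, ?_, hright.sub (hleft.comp hneg)⟩
    rw [sub_neg_eq_add, abs_of_pos (by positivity), two_mul]

end Angle

section WindingNumber

variable {n : ℕ} {P : Polygon Plane n} {z z' : Plane}

lemma mem_boundary_iff :
    z ∈ P.boundary ℝ ↔ ∃ i, z ∈ segment ℝ (P i) (P (finRotate n i)) := by
  simp only [boundary, edgeSet, affineSegment_eq_segment, mem_iUnion]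

lemma vertex_mem_boundary (P : Polygon Plane n) (i : Fin n) : P i ∈ P.boundary ℝ :=
  mem_boundary_iff.2 ⟨i, left_mem_segment _ _ _⟩

lemma notMem_edge_of_notMem_boundary (hz : z ∉ P.boundary ℝ) (i : Fin n) :
    z ∉ segment ℝ (P i) (P (finRotate n i)) := fun h => hz (mem_boundary_iff.2 ⟨i, h⟩)

lemma isCompact_boundary (P : Polygon Plane n) : IsCompact (P.boundary ℝ) :=
  isCompact_iUnion fun i => by
    rw [edgeSet, affineSegment_eq_segment]; exact isCompact_segment _ _

lemma isClosed_boundary (P : Polygon Plane n) : IsClosed (P.boundary ℝ) :=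
  (isCompact_boundary P).isClosed

/-- The winding number of the boundary of a polygon around a point, as a real number. It is an
integer for points off the boundary and a junk value on the boundary. -/
noncomputable def windingNumber (P : Polygon Plane n) (z : Plane) : ℝ :=
  (∑ i, visualAngle (P i) (P (finRotate n i)) z) / (2 * Real.pi)

lemma continuousAt_windingNumber (hz : z ∉ P.boundary ℝ) : ContinuousAt (windingNumber P) z :=
  Tendsto.div_const (tendsto_finsetSum _ fun i _ =>
    continuousAt_visualAngle (notMem_edge_of_notMem_boundary hz i)) _

lemma exists_int_eq_windingNumber (hz : z ∉ P.boundary ℝ) :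
    ∃ k : ℤ, windingNumber P z = k := by
  have hne : ∀ i, P i ≠ z := fun i hi => hz (hi ▸ vertex_mem_boundary P i)
  have hsum : ((∑ i, visualAngle (P i) (P (finRotate n i)) z : ℝ) : Real.Angle) = 0 := by
    calc ((∑ i, visualAngle (P i) (P (finRotate n i)) z : ℝ) : Real.Angle)
        = ∑ i, (visualAngle (P i) (P (finRotate n i)) z : Real.Angle) :=
          map_sum Real.Angle.coeHom _ _
      _ = ∑ i, ((Complex.arg (toComplex (P (finRotate n i) - z)) : Real.Angle) -
            (Complex.arg (toComplex (P i - z)) : Real.Angle)) :=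
          Finset.sum_congr rfl fun i _ => Complex.arg_div_coe_angle
            (toComplex_sub_ne_zero (hne _)) (toComplex_sub_ne_zero (hne i))
      _ = 0 := by
          rw [Finset.sum_sub_distrib, Equiv.sum_comp (finRotate n)
            fun i => ((toComplex (P i - z)).arg : Real.Angle), sub_self]
  obtain ⟨k, hk⟩ := Real.Angle.coe_eq_zero_iff.1 hsum
  refine ⟨k, ?_⟩
  rw [windingNumber, ← hk, zsmul_eq_mul, mul_div_cancel_right₀ _ Real.two_pi_pos.ne']

lemma windingNumber_eq_of_isPreconnected {S : Set Plane} (hS : IsPreconnected S)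
    (hd : Disjoint S (P.boundary ℝ)) (hz : z ∈ S) (hz' : z' ∈ S) :
    windingNumber P z = windingNumber P z' := by
  have hoff : ∀ y ∈ S, y ∉ P.boundary ℝ := fun y hy => disjoint_left.1 hd hy
  have hdiscrete : IsDiscrete (range ((↑) : ℤ → ℝ)) :=
    Int.isClosedEmbedding_coe_real.isEmbedding.isDiscrete_range
  refine hS.constant_of_mapsTo hdiscrete
    (fun y hy => (continuousAt_windingNumber (hoff y hy)).continuousWithinAt)
    (fun y hy => ?_) hz hz'
  obtain ⟨k, hk⟩ := exists_int_eq_windingNumber (hoff y hy)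
  exact ⟨k, hk.symm⟩

lemma exists_windingNumber_eq_zero_of_norm_gt (P : Polygon Plane n) :
    ∃ R : ℝ, ∀ z, R < ‖z‖ → z ∉ P.boundary ℝ ∧ windingNumber P z = 0 := by
  have hlim : Tendsto (windingNumber P) (Bornology.cobounded Plane) (𝓝 0) := by
    have h := (tendsto_finsetSum (Finset.univ : Finset (Fin n)) fun i _ =>
      tendsto_visualAngle_cobounded (P i) (P (finRotate n i))).div_const (2 * Real.pi)
    rw [Finset.sum_const_zero, zero_div] at h
    exact h
  have hoff : ∀ᶠ z in Bornology.cobounded Plane, z ∉ P.boundary ℝ :=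
    (isCompact_boundary P).isBounded
  have hzero : ∀ᶠ z in Bornology.cobounded Plane, z ∉ P.boundary ℝ ∧ windingNumber P z = 0 := by
    filter_upwards [hoff, Metric.tendsto_nhds.1 hlim 1 one_pos] with z hz hlt
    obtain ⟨k, hk⟩ := exists_int_eq_windingNumber hz
    rw [Real.dist_0_eq_abs, hk] at hlt
    have hk₀ : k = 0 := Int.abs_lt_one_iff.1 (by exact_mod_cast hlt)
    exact ⟨hz, by rw [hk, hk₀, Int.cast_zero]⟩
  obtain ⟨R, -, hR⟩ := (hasBasis_cobounded_norm (E := Plane)).eventually_iff.1 hzero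
  exact ⟨R, fun z hz => hR hz.le⟩

lemma eventually_mem_boundary_iff (P : Polygon Plane n) (z : Plane) :
    ∀ᶠ y in 𝓝 z, y ∈ P.boundary ℝ ↔ ∃ i, z ∈ segment ℝ (P i) (P (finRotate n i)) ∧
      y ∈ segment ℝ (P i) (P (finRotate n i)) := by
  have hnear : ∀ᶠ y in 𝓝 z, ∀ i, z ∉ segment ℝ (P i) (P (finRotate n i)) →
      y ∉ segment ℝ (P i) (P (finRotate n i)) := by
    simp only [eventually_all]
    exact fun i hi => (isCompact_segment _ _).isClosed.isOpen_compl.mem_nhds hi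
  filter_upwards [hnear] with y hy
  rw [mem_boundary_iff]
  exact exists_congr fun i => ⟨fun h => ⟨not_imp_not.1 (hy i) h, h⟩, And.right⟩

lemma eventually_add_smul_notMem_boundary {i : Fin n} {d : Plane}
    (hz : z ∈ segment ℝ (P i) (P (finRotate n i)))
    (hother : ∀ j, j ≠ i → z ∉ segment ℝ (P j) (P (finRotate n j)))
    (hd : LinearIndependent ℝ ![P (finRotate n i) - P i, d]) :
    ∀ᶠ t in 𝓝[≠] (0 : ℝ), z + t • d ∉ P.boundary ℝ := by
  filter_upwards [((tendsto_add_smul_nhds_zero z d).mono_left nhdsWithin_le_nhds).eventually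
    (eventually_mem_boundary_iff P z), self_mem_nhdsWithin] with t hiff (ht : t ≠ 0) hmem
  obtain ⟨j, hzj, hj⟩ := hiff.1 hmem
  obtain rfl : j = i := by_contra fun hji => hother j hji hzj
  exact add_smul_notMem_segment hd hz ht hj

lemma tendsto_neg_nhdsGT_zero_nhdsNE : Tendsto (fun t : ℝ => -t) (𝓝[>] 0) (𝓝[≠] 0) :=
  tendsto_nhdsWithin_of_tendsto_nhds_of_eventually_within _
    (by simpa using ((continuous_neg.tendsto (0 : ℝ)).mono_left nhdsWithin_le_nhds))
    (eventually_nhdsWithin_of_forall fun _ (ht : 0 < _) => neg_ne_zero.2 ht.ne')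

lemma eventually_abs_windingNumber_sub_eq_one {i : Fin n} {d : Plane}
    (hz : z ∈ openSegment ℝ (P i) (P (finRotate n i)))
    (hother : ∀ j, j ≠ i → z ∉ segment ℝ (P j) (P (finRotate n j)))
    (hd : LinearIndependent ℝ ![P (finRotate n i) - P i, d]) :
    ∀ᶠ t in 𝓝[>] (0 : ℝ), z + t • d ∉ P.boundary ℝ ∧ z + (-t) • d ∉ P.boundary ℝ ∧
      |windingNumber P (z + t • d) - windingNumber P (z + (-t) • d)| = 1 := by
  have hoff := eventually_add_smul_notMem_boundary (openSegment_subset_segment _ _ _ hz) hother hd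
  have hplus : Tendsto (fun t : ℝ => z + t • d) (𝓝[>] 0) (𝓝 z) :=
    (tendsto_add_smul_nhds_zero z d).mono_left nhdsWithin_le_nhds
  have hminus : Tendsto (fun t : ℝ => z + (-t) • d) (𝓝[>] 0) (𝓝 z) :=
    (tendsto_add_smul_nhds_zero z d).comp
      (tendsto_neg_nhdsGT_zero_nhdsNE.mono_right nhdsWithin_le_nhds)
  obtain ⟨a, ha, hjump⟩ := exists_tendsto_visualAngle_sub hd hz
  have hrest : ContinuousAt (fun y => ∑ j ∈ Finset.univ.erase i,
      visualAngle (P j) (P (finRotate n j)) y) z := tendsto_finsetSum _ fun j hj =>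
    continuousAt_visualAngle (hother j (Finset.ne_of_mem_erase hj))
  have hlim : Tendsto (fun t : ℝ => |windingNumber P (z + t • d) - windingNumber P (z + (-t) • d)|)
      (𝓝[>] 0) (𝓝 1) := by
    have h := ((hjump.add ((hrest.tendsto.comp hplus).sub
      (hrest.tendsto.comp hminus))).div_const (2 * Real.pi)).abs
    rw [sub_self, add_zero, abs_div, ha, abs_of_pos Real.two_pi_pos,
      div_self Real.two_pi_pos.ne'] at h
    refine h.congr fun t => ?_
    simp only [windingNumber, Function.comp_apply, ← Finset.add_sum_erase _ _ (Finset.mem_univ i)]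
    congr 1
    ring
  filter_upwards [hoff.filter_mono (nhdsWithin_mono _ fun t (ht : 0 < t) => ht.ne'),
    tendsto_neg_nhdsGT_zero_nhdsNE.eventually hoff, Metric.tendsto_nhds.1 hlim 1 one_pos]
    with t hp hm hlt
  obtain ⟨k, hk⟩ := exists_int_eq_windingNumber hp
  obtain ⟨l, hl⟩ := exists_int_eq_windingNumber hm
  refine ⟨hp, hm, ?_⟩
  rw [hk, hl, Real.dist_eq] at hlt
  rw [hk, hl]
  have hint : |(|k - l| - 1)| < 1 := by exact_mod_cast hlt
  exact_mod_cast sub_eq_zero.1 (Int.abs_lt_one_iff.1 hint)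

end WindingNumber

/-! ### Locally two-sided sets -/

section TwoSided

variable {X : Type*} [TopologicalSpace X] {C : Set X} {p z : X}

/-- Near `p`, the set `C` divides the space into two connected sides, both of which accumulate at
all points of `C` near `p`. For a curve this is what the Jordan curve theorem needs locally. -/
def TwoSidedAt (C : Set X) (p : X) : Prop :=
  ∃ B S₁ S₂ : Set X, IsOpen B ∧ p ∈ B ∧ IsPreconnected S₁ ∧ IsPreconnected S₂ ∧
    S₁ ∪ S₂ = B \ C ∧ B ∩ C ⊆ closure S₁ ∧ B ∩ C ⊆ closure S₂

lemma subset_connectedComponentIn_or_subset {B S₁ S₂ : Set X} (hB : IsOpen B)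
    (h₁ : IsPreconnected S₁) (h₂ : IsPreconnected S₂) (h : S₁ ∪ S₂ = B \ C)
    (hp : p ∈ B) (hpz : p ∈ closure (connectedComponentIn Cᶜ z)) :
    S₁ ⊆ connectedComponentIn Cᶜ z ∨ S₂ ⊆ connectedComponentIn Cᶜ z := by
  obtain ⟨y, hyB, hyz⟩ := mem_closure_iff.1 hpz B hB hp
  have hsub : S₁ ∪ S₂ ⊆ Cᶜ := h.trans_subset fun _ hw => hw.2
  rw [connectedComponentIn_eq hyz]
  have hy : y ∈ S₁ ∪ S₂ := h ▸ ⟨hyB, connectedComponentIn_subset _ _ hyz⟩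
  exact hy.imp (fun hy => h₁.subset_connectedComponentIn hy (subset_union_left.trans hsub))
    fun hy => h₂.subset_connectedComponentIn hy (subset_union_right.trans hsub)

lemma inter_closure_connectedComponentIn_nonempty [PreconnectedSpace X] [LocallyConnectedSpace X]
    (hC : IsClosed C) (hne : C.Nonempty) (hz : z ∉ C) :
    (C ∩ closure (connectedComponentIn Cᶜ z)).Nonempty := by
  set O := connectedComponentIn Cᶜ z
  have hzO : z ∈ O := mem_connectedComponentIn hz
  by_contra hempty
  have hclosed : closure O ⊆ O :=
    isPreconnected_connectedComponentIn.closure.subset_connectedComponentIn (subset_closure hzO)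
      fun y hy hyC => hempty ⟨y, hyC, hy⟩
  have huniv : O = univ :=
    IsClopen.eq_univ ⟨closure_subset_iff_isClosed.1 hclosed, hC.isOpen_compl.connectedComponentIn⟩
      ⟨z, hzO⟩
  obtain ⟨c, hc⟩ := hne
  exact connectedComponentIn_subset _ _ (huniv.symm ▸ mem_univ c : c ∈ O) hc

lemma subset_closure_connectedComponentIn [PreconnectedSpace X] [LocallyConnectedSpace X]
    (hC : IsClosed C) (hconn : IsConnected C) (htwo : ∀ p ∈ C, TwoSidedAt C p) (hz : z ∉ C) :
    C ⊆ closure (connectedComponentIn Cᶜ z) := by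
  obtain ⟨c, hcC, hc⟩ := inter_closure_connectedComponentIn_nonempty hC hconn.nonempty hz
  intro y hy
  refine (hconn.isPreconnected.induction₂ (fun x y => x ∈ closure (connectedComponentIn Cᶜ z) ↔
    y ∈ closure (connectedComponentIn Cᶜ z)) (fun x hx => ?_) (fun _ _ _ _ _ _ h h' => h.trans h')
    (fun _ _ _ _ h => h.symm) hcC hy).1 hc
  obtain ⟨B, S₁, S₂, hB, hxB, h₁, h₂, h, hcl₁, hcl₂⟩ := htwo x hx
  have hspread : ∀ p ∈ B, p ∈ closure (connectedComponentIn Cᶜ z) →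
      B ∩ C ⊆ closure (connectedComponentIn Cᶜ z) := fun p hp hpz =>
    (subset_connectedComponentIn_or_subset hB h₁ h₂ h hp hpz).elim
      (fun hS => hcl₁.trans (closure_mono hS)) fun hS => hcl₂.trans (closure_mono hS)
  filter_upwards [mem_nhdsWithin_of_mem_nhds (hB.mem_nhds hxB), self_mem_nhdsWithin] with y hyB hyC
  exact ⟨fun hxz => hspread x hxB hxz ⟨hyB, hyC⟩, fun hyz => hspread y hyB hyz ⟨hxB, hx⟩⟩

end TwoSided

section LinearSides

variable {E : Type*} [NormedAddCommGroup E] [NormedSpace ℝ E] {C : Set E} {p z d : E}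

lemma mem_closure_of_eventually_add_smul_mem {S : Set E}
    (h : ∀ᶠ t in 𝓝[>] (0 : ℝ), z + t • d ∈ S) : z ∈ closure S :=
  mem_closure_of_tendsto ((tendsto_add_smul_nhds_zero z d).mono_left nhdsWithin_le_nhds) h

lemma isPreconnected_ball_inter_pos (A : E →L[ℝ] ℝ) (p : E) (ε : ℝ) :
    IsPreconnected (Metric.ball p ε ∩ {z | 0 < A (z - p)}) := by
  simp_rw [map_sub, sub_pos]
  exact ((convex_ball p ε).inter (convex_halfSpace_gt A.isLinear (A p))).isPreconnected

lemma eventually_add_smul_mem_ball_inter_pos {A : E →L[ℝ] ℝ} {ε : ℝ} (hz : z ∈ Metric.ball p ε)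
    (hA : 0 ≤ A (z - p)) (hd : 0 < A d) :
    ∀ᶠ t in 𝓝[>] (0 : ℝ), z + t • d ∈ Metric.ball p ε ∩ {z | 0 < A (z - p)} := by
  filter_upwards [((tendsto_add_smul_nhds_zero z d).mono_left nhdsWithin_le_nhds).eventually
    (Metric.isOpen_ball.mem_nhds hz), self_mem_nhdsWithin] with t ht (ht₀ : 0 < t)
  refine ⟨ht, ?_⟩
  rw [mem_ofPred_eq, add_sub_right_comm, map_add, map_smul, smul_eq_mul]
  positivity

lemma twoSidedAt_of_eq_zero {A : E →L[ℝ] ℝ} (hd : 0 < A d)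
    (hC : ∀ᶠ z in 𝓝 p, z ∈ C ↔ A (z - p) = 0) : TwoSidedAt C p := by
  obtain ⟨ε, hε, hball⟩ := Metric.eventually_nhds_iff_ball.1 hC
  refine ⟨Metric.ball p ε, _, _, Metric.isOpen_ball, Metric.mem_ball_self hε,
    isPreconnected_ball_inter_pos A p ε, isPreconnected_ball_inter_pos (-A) p ε, ?_, ?_, ?_⟩
  · ext z
    simp only [mem_union, mem_inter_iff, Set.mem_sdiff, mem_ofPred_eq, ← and_or_left, neg_apply,
      neg_pos]
    exact and_congr_right fun hz => by rw [hball z hz, or_comm]; exact lt_or_lt_iff_ne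
  · rintro z ⟨hz, hzC⟩
    exact mem_closure_of_eventually_add_smul_mem
      (eventually_add_smul_mem_ball_inter_pos hz ((hball z hz).1 hzC).ge hd)
  · rintro z ⟨hz, hzC⟩
    have hz₀ : (-A) (z - p) = 0 := by
      rw [neg_apply, (hball z hz).1 hzC, neg_zero]
    exact mem_closure_of_eventually_add_smul_mem (d := -d)
      (eventually_add_smul_mem_ball_inter_pos hz hz₀.ge (by simpa using hd))

/-- The two sides of an angle are an open quadrant and the union of two half-discs that overlap in
the opposite quadrant. -/
lemma twoSidedAt_of_nonneg {A B : E →L[ℝ] ℝ} {e₁ e₂ : E} (hA₁ : A e₁ = 1) (hA₂ : A e₂ = 0)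
    (hB₁ : B e₁ = 0) (hB₂ : B e₂ = 1)
    (hC : ∀ᶠ z in 𝓝 p, z ∈ C ↔
      0 ≤ A (z - p) ∧ B (z - p) = 0 ∨ A (z - p) = 0 ∧ 0 ≤ B (z - p)) : TwoSidedAt C p := by
  obtain ⟨ε, hε, hball⟩ := Metric.eventually_nhds_iff_ball.1 hC
  set H : (E →L[ℝ] ℝ) → Set E := fun L => Metric.ball p ε ∩ {z | 0 < L (z - p)} with hH
  have hconvex : Convex ℝ (H A ∩ H B) := by
    simp only [hH, map_sub, sub_pos]
    exact ((convex_ball p ε).inter (convex_halfSpace_gt A.isLinear (A p))).inter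
      ((convex_ball p ε).inter (convex_halfSpace_gt B.isLinear (B p)))
  have hoverlap : (H (-A) ∩ H (-B)).Nonempty := by
    have hp : p ∈ Metric.ball p ε := Metric.mem_ball_self hε
    have hA : ∀ᶠ t in 𝓝[>] (0 : ℝ), p + t • (-e₁ - e₂) ∈ H (-A) :=
      eventually_add_smul_mem_ball_inter_pos hp (by simp) (by simp [hA₁, hA₂])
    have hB : ∀ᶠ t in 𝓝[>] (0 : ℝ), p + t • (-e₁ - e₂) ∈ H (-B) :=
      eventually_add_smul_mem_ball_inter_pos hp (by simp) (by simp [hB₁, hB₂])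
    exact (hA.and hB).exists.imp' _ fun _ h => h
  refine ⟨Metric.ball p ε, H A ∩ H B, H (-A) ∪ H (-B), Metric.isOpen_ball,
    Metric.mem_ball_self hε, hconvex.isPreconnected,
    (isPreconnected_ball_inter_pos _ p ε).union' hoverlap (isPreconnected_ball_inter_pos _ p ε),
    ?_, ?_, ?_⟩
  · ext z
    simp only [hH, mem_union, mem_inter_iff, Set.mem_sdiff, mem_ofPred_eq,
      neg_apply, neg_pos]
    by_cases hz : z ∈ Metric.ball p ε
    · rw [hball z hz]
      grind
    · simp only [hz, false_and, or_self]
  · rintro z ⟨hz, hzC⟩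
    have hnonneg : 0 ≤ A (z - p) ∧ 0 ≤ B (z - p) := by grind
    exact mem_closure_of_eventually_add_smul_mem (d := e₁ + e₂)
      ((eventually_add_smul_mem_ball_inter_pos hz hnonneg.1 (by simp [hA₁, hA₂])).and
        (eventually_add_smul_mem_ball_inter_pos hz hnonneg.2 (by simp [hB₁, hB₂])))
  · rintro z ⟨hz, hzC⟩
    rcases (hball z hz).1 hzC with ⟨-, hB⟩ | ⟨hA, -⟩
    · refine closure_mono subset_union_right (mem_closure_of_eventually_add_smul_mem (d := -e₂)
        (eventually_add_smul_mem_ball_inter_pos hz ?_ ?_))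
      · simp [hB]
      · simp [hB₂]
    · refine closure_mono subset_union_left (mem_closure_of_eventually_add_smul_mem (d := -e₁)
        (eventually_add_smul_mem_ball_inter_pos hz ?_ ?_))
      · simp [hA]
      · simp [hA₁]

end LinearSides

section LocalSegments

variable {C : Set Plane} {p q₁ q₂ z e₁ e₂ : Plane}

lemma exists_dual_coordinates (h : LinearIndependent ℝ ![e₁, e₂]) :
    ∃ A B : Plane →L[ℝ] ℝ, A e₁ = 1 ∧ A e₂ = 0 ∧ B e₁ = 0 ∧ B e₂ = 1 ∧
      ∀ x, x = A x • e₁ + B x • e₂ := by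
  let b := basisOfLinearIndependentOfCardEqFinrank h (by simp)
  have hb : ⇑b = ![e₁, e₂] := coe_basisOfLinearIndependentOfCardEqFinrank _ _
  have hb₁ : b 0 = e₁ := congrFun hb 0
  have hb₂ : b 1 = e₂ := congrFun hb 1
  refine ⟨(b.coord 0).toContinuousLinearMap, (b.coord 1).toContinuousLinearMap, ?_, ?_, ?_, ?_,
    fun x => ?_⟩
  · simp [← hb₁]
  · simp [← hb₂]
  · simp [← hb₁]
  · simp [← hb₂]
  · have hx := b.sum_repr x
    rw [Fin.sum_univ_two, hb₁, hb₂] at hx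
    exact hx.symm

lemma mem_segment_iff_of_coordinates {A B : Plane →L[ℝ] ℝ} (hA : A (q₁ - p) = 1)
    (hB : B (q₁ - p) = 0) (hAB : ∀ x, x = A x • (q₁ - p) + B x • e₂) :
    z ∈ segment ℝ p q₁ ↔ A (z - p) ∈ Icc 0 1 ∧ B (z - p) = 0 := by
  rw [segment_eq_image']
  constructor
  · rintro ⟨t, ht, rfl⟩
    simpa [hA, hB] using ht
  · rintro ⟨ht, hB₀⟩
    refine ⟨_, ht, ?_⟩
    have h := hAB (z - p)
    rw [hB₀, zero_smul, add_zero] at h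
    exact (sub_eq_iff_eq_add'.1 h).symm

lemma twoSidedAt_of_mem_openSegment (hne : q₁ ≠ q₂) (hp : p ∈ openSegment ℝ q₁ q₂)
    (hC : ∀ᶠ z in 𝓝 p, z ∈ C ↔ z ∈ segment ℝ q₁ q₂) : TwoSidedAt C p := by
  obtain ⟨d, hd⟩ := exists_linearIndependent_pair_of_one_lt_finrank (R := ℝ) (M := Plane)
    (by simp) (sub_ne_zero.2 hne.symm)
  obtain ⟨A, B, hA₁, -, hB₁, hB₂, hAB⟩ := exists_dual_coordinates hd
  obtain ⟨t, ht, hpt⟩ := mem_openSegment_iff_exists_add_smul.1 hp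
  have hAp : A (p - q₁) = t := by rw [hpt, add_sub_cancel_left, map_smul, hA₁, smul_eq_mul, mul_one]
  have hBp : B (p - q₁) = 0 := by rw [hpt, add_sub_cancel_left, map_smul, hB₁, smul_zero]
  have hnear : ∀ᶠ z in 𝓝 p, A (z - q₁) ∈ Ioo 0 1 :=
    (by fun_prop : Continuous fun z => A (z - q₁)).continuousAt.eventually_mem
      (isOpen_Ioo.mem_nhds (hAp.symm ▸ ht))
  refine twoSidedAt_of_eq_zero (A := B) (d := d) (hB₂ ▸ one_pos) ?_
  filter_upwards [hC, hnear] with z hz hAz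
  rw [hz, mem_segment_iff_of_coordinates hA₁ hB₁ hAB,
    and_iff_right (Ioo_subset_Icc_self hAz), ← sub_add_sub_cancel z p q₁, map_add, hBp, add_zero]

lemma twoSidedAt_of_linearIndependent (hli : LinearIndependent ℝ ![q₁ - p, q₂ - p])
    (hC : ∀ᶠ z in 𝓝 p, z ∈ C ↔ z ∈ segment ℝ p q₁ ∪ segment ℝ p q₂) : TwoSidedAt C p := by
  obtain ⟨A, B, hA₁, hA₂, hB₁, hB₂, hAB⟩ := exists_dual_coordinates hli
  refine twoSidedAt_of_nonneg hA₁ hA₂ hB₁ hB₂ ?_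
  have hnear : ∀ L : Plane →L[ℝ] ℝ, ∀ᶠ z in 𝓝 p, L (z - p) < 1 := fun L =>
    (by fun_prop : Continuous fun z => L (z - p)).continuousAt.eventually_lt continuousAt_const
      (by simp)
  filter_upwards [hC, hnear A, hnear B] with z hz hAz hBz
  rw [hz, mem_union, mem_segment_iff_of_coordinates hA₁ hB₁ hAB,
    mem_segment_iff_of_coordinates hB₂ hA₂ fun x => (hAB x).trans (add_comm _ _), mem_Icc, mem_Icc,
    and_iff_left hAz.le, and_iff_left hBz.le, and_comm (a := 0 ≤ B (z - p))]

lemma mem_openSegment_of_not_linearIndependent (h₁ : q₁ ≠ p) (h₂ : q₂ ≠ p)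
    (hinter : segment ℝ p q₁ ∩ segment ℝ p q₂ ⊆ {p})
    (hli : ¬ LinearIndependent ℝ ![q₁ - p, q₂ - p]) : p ∈ openSegment ℝ q₁ q₂ := by
  obtain ⟨r, hr⟩ : ∃ r : ℝ, r • (q₁ - p) = q₂ - p := by
    simpa [LinearIndependent.pair_iff' (sub_ne_zero.2 h₁)] using hli
  have hrneg : r ≤ 0 := by
    by_contra! hpos
    have hs₀ : 0 < min 1 r := lt_min one_pos hpos
    have hs : p + (min 1 r) • (q₁ - p) = p := hinter ⟨?_, ?_⟩
    · exact (smul_ne_zero hs₀.ne' (sub_ne_zero.2 h₁)) (add_eq_left.1 hs)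
    · exact (segment_eq_image' ℝ p q₁).symm ▸ ⟨_, ⟨hs₀.le, min_le_left _ _⟩, rfl⟩
    · refine (segment_eq_image' ℝ p q₂).symm ▸ ⟨min 1 r / r, ⟨by positivity, ?_⟩, ?_⟩
      · exact (div_le_one hpos).2 (min_le_right _ _)
      · simp only [← hr, smul_smul, div_mul_cancel₀ _ hpos.ne']
  refine mem_openSegment_of_ne_left_right h₁ h₂ (mem_segment_iff_sameRay.2 ?_)
  rw [← hr, ← neg_sub q₁ p, ← neg_smul_neg]
  exact SameRay.sameRay_nonneg_smul_right _ (neg_nonneg.2 hrneg)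

lemma segment_eq_union_of_mem_openSegment (hp : p ∈ openSegment ℝ q₁ q₂) :
    segment ℝ q₁ q₂ = segment ℝ p q₁ ∪ segment ℝ p q₂ := by
  have hp' := openSegment_subset_segment _ _ _ hp
  refine Subset.antisymm (fun z hz => ?_) (union_subset
    ((convex_segment _ _).segment_subset hp' (left_mem_segment _ _ _))
    ((convex_segment _ _).segment_subset hp' (right_mem_segment _ _ _)))
  rw [segment_symm ℝ p q₁]
  rcases eq_or_eq_or_mem_openSegment_of_mem_segment hz with rfl | rfl | hz
  · exact Or.inl (left_mem_segment _ _ _)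
  · exact Or.inr (right_mem_segment _ _ _)
  · rw [openSegment_eq_image_lineMap] at hp
    rcases openSegment_subset_union q₁ q₂ (image_subset_range _ _ hp) hz with rfl | hz | hz
    · exact Or.inl (right_mem_segment _ _ _)
    · exact Or.inl (openSegment_subset_segment _ _ _ hz)
    · exact Or.inr (openSegment_subset_segment _ _ _ hz)

lemma twoSidedAt_of_union_segment (h₁ : q₁ ≠ p) (h₂ : q₂ ≠ p)
    (hinter : segment ℝ p q₁ ∩ segment ℝ p q₂ ⊆ {p})
    (hC : ∀ᶠ z in 𝓝 p, z ∈ C ↔ z ∈ segment ℝ p q₁ ∪ segment ℝ p q₂) : TwoSidedAt C p := by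
  by_cases hli : LinearIndependent ℝ ![q₁ - p, q₂ - p]
  · exact twoSidedAt_of_linearIndependent hli hC
  · have hp := mem_openSegment_of_not_linearIndependent h₁ h₂ hinter hli
    rw [← segment_eq_union_of_mem_openSegment hp] at hC
    refine twoSidedAt_of_mem_openSegment ?_ hp hC
    rintro rfl
    rw [openSegment_same] at hp
    exact h₁ hp.symm

end LocalSegments

section CyclicOrder

variable {n : ℕ} {a b c : Fin n}

lemma val_finRotate (i : Fin n) :
    (finRotate n i).val = if i.val + 1 = n then 0 else i.val + 1 := by
  obtain ⟨m, rfl⟩ : ∃ m, n = m + 1 := ⟨n - 1, by have := i.2; lia⟩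
  simp only [coe_finRotate, Fin.ext_iff, Fin.val_last, add_left_inj]

lemma btw_iff_val : btw a b c ↔
    (a.val ≤ b.val ∧ b.val ≤ c.val ∨ b.val ≤ c.val ∧ c.val ≤ a.val ∨
      c.val ≤ a.val ∧ a.val ≤ b.val) := Iff.rfl

lemma sbtw_iff_val : sbtw a b c ↔
    (a.val < b.val ∧ b.val < c.val ∨ b.val < c.val ∧ c.val < a.val ∨
      c.val < a.val ∧ a.val < b.val) := Iff.rfl

lemma finRotate_ne_self (h : 2 ≤ n) (i : Fin n) : finRotate n i ≠ i := by
  rw [Ne, Fin.ext_iff, val_finRotate]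
  split_ifs <;> lia

end CyclicOrder

/-! ### The Jordan curve theorem for simple polygons -/

section Edges

variable {n : ℕ} {P : Polygon Plane n} {i j : Fin n} {z : Plane}

lemma vertex_ne_vertex_finRotate (hP : P.IsSimple) (i : Fin n) : P i ≠ P (finRotate n i) :=
  hP.injective.ne (finRotate_ne_self (by have := hP.three_le; lia) i).symm

lemma eq_vertex_of_mem_edge_of_mem_edge_finRotate (hP : P.IsSimple)
    (h : z ∈ segment ℝ (P i) (P (finRotate n i)))
    (h' : z ∈ segment ℝ (P (finRotate n i)) (P (finRotate n (finRotate n i)))) :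
    z = P (finRotate n i) := by
  have hinter := hP.consecutive i
  rw [edgeSet, edgeSet, affineSegment_eq_segment, affineSegment_eq_segment] at hinter
  exact hinter.subset ⟨h, h'⟩

lemma eq_vertex_of_mem_edge_of_mem_edge (hP : P.IsSimple) (hij : i ≠ j)
    (hi : z ∈ segment ℝ (P i) (P (finRotate n i)))
    (hj : z ∈ segment ℝ (P j) (P (finRotate n j))) :
    (j = finRotate n i ∧ z = P j) ∨ (i = finRotate n j ∧ z = P i) := by
  by_cases hsucc : j = finRotate n i
  · subst hsucc
    exact Or.inl ⟨rfl, eq_vertex_of_mem_edge_of_mem_edge_finRotate hP hi hj⟩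
  by_cases hpred : i = finRotate n j
  · subst hpred
    exact Or.inr ⟨rfl, eq_vertex_of_mem_edge_of_mem_edge_finRotate hP hj hi⟩
  have hdisj := hP.nonconsecutive i j hij.symm hsucc hpred
  rw [edgeSet, edgeSet, affineSegment_eq_segment, affineSegment_eq_segment] at hdisj
  exact absurd hj (disjoint_left.1 hdisj hi)

lemma eq_or_eq_finRotate_of_vertex_mem_edge (hP : P.IsSimple)
    (h : P i ∈ segment ℝ (P j) (P (finRotate n j))) : i = j ∨ i = finRotate n j := by
  by_contra! hne
  rcases eq_vertex_of_mem_edge_of_mem_edge hP hne.1 (left_mem_segment _ _ _) h with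
    ⟨-, hij⟩ | ⟨hij, -⟩
  · exact hne.1 (hP.injective hij)
  · exact hne.2 hij

lemma vertex_notMem_openSegment_edge (hP : P.IsSimple) (i j : Fin n) :
    P i ∉ openSegment ℝ (P j) (P (finRotate n j)) := by
  intro h
  have hne := vertex_ne_vertex_finRotate hP j
  rcases eq_or_eq_finRotate_of_vertex_mem_edge hP (openSegment_subset_segment _ _ _ h) with
    rfl | rfl
  · exact hne (left_mem_openSegment_iff.1 h)
  · exact hne (right_mem_openSegment_iff.1 h)

lemma notMem_edge_of_mem_openSegment_edge (hP : P.IsSimple) (hij : j ≠ i)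
    (hz : z ∈ openSegment ℝ (P i) (P (finRotate n i))) :
    z ∉ segment ℝ (P j) (P (finRotate n j)) := by
  intro hj
  rcases eq_vertex_of_mem_edge_of_mem_edge hP hij hj (openSegment_subset_segment _ _ _ hz) with
    ⟨-, rfl⟩ | ⟨-, rfl⟩ <;> exact vertex_notMem_openSegment_edge hP _ _ hz

lemma twoSidedAt_boundary_of_mem_openSegment (hP : P.IsSimple)
    (hz : z ∈ openSegment ℝ (P i) (P (finRotate n i))) : TwoSidedAt (P.boundary ℝ) z := by
  refine twoSidedAt_of_mem_openSegment (vertex_ne_vertex_finRotate hP i) hz ?_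
  filter_upwards [eventually_mem_boundary_iff P z] with y hy
  rw [hy]
  constructor
  · rintro ⟨j, hzj, hyj⟩
    obtain rfl : j = i :=
      by_contra fun hji => notMem_edge_of_mem_openSegment_edge hP hji hz hzj
    exact hyj
  · exact fun hyi => ⟨i, openSegment_subset_segment _ _ _ hz, hyi⟩

lemma twoSidedAt_boundary_vertex (hP : P.IsSimple) (i : Fin n) :
    TwoSidedAt (P.boundary ℝ) (P (finRotate n i)) := by
  refine twoSidedAt_of_union_segment (vertex_ne_vertex_finRotate hP i)
    (vertex_ne_vertex_finRotate hP (finRotate n i)).symm ?_ ?_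
  · rintro z ⟨hz, hz'⟩
    rw [segment_symm] at hz
    exact eq_vertex_of_mem_edge_of_mem_edge_finRotate hP hz hz'
  · filter_upwards [eventually_mem_boundary_iff P (P (finRotate n i))] with y hy
    rw [hy, segment_symm ℝ _ (P i)]
    constructor
    · rintro ⟨j, hj, hyj⟩
      rcases eq_or_eq_finRotate_of_vertex_mem_edge hP hj with rfl | h
      · exact Or.inr hyj
      · rw [← (finRotate n).injective h] at hyj
        exact Or.inl hyj
    · rintro (h | h)
      · exact ⟨i, right_mem_segment _ _ _, h⟩
      · exact ⟨_, left_mem_segment _ _ _, h⟩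

lemma twoSidedAt_boundary (hP : P.IsSimple) (hz : z ∈ P.boundary ℝ) :
    TwoSidedAt (P.boundary ℝ) z := by
  obtain ⟨i, hi⟩ := mem_boundary_iff.1 hz
  rcases eq_or_eq_or_mem_openSegment_of_mem_segment hi with rfl | rfl | hi
  · rw [← (finRotate n).apply_symm_apply i]
    exact twoSidedAt_boundary_vertex hP _
  · exact twoSidedAt_boundary_vertex hP i
  · exact twoSidedAt_boundary_of_mem_openSegment hP hi

lemma isPreconnected_boundary (P : Polygon Plane n) : IsPreconnected (P.boundary ℝ) := by
  have hedge (i : Fin n) : P.edgeSet ℝ i = segment ℝ (P i) (P (finRotate n i)) :=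
    affineSegment_eq_segment _ _ _
  refine IsPreconnected.iUnion_of_chain (fun i => ?_) fun i => ?_
  · rw [hedge]
    exact (convex_segment _ _).isPreconnected
  · have hsucc : Order.succ i = i ∨ Order.succ i = finRotate n i := by
      obtain ⟨m, rfl⟩ : ∃ m, n = m + 1 := ⟨n - 1, by have := i.2; lia⟩
      cases i using Fin.lastCases with
      | last => exact Or.inl (Fin.orderSucc_last m)
      | cast i =>
        right
        rw [Fin.orderSucc_castSucc, finRotate_apply, Fin.coeSucc_eq_succ]
    rw [hedge, hedge]
    rcases hsucc with h | h <;> rw [h]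
    · exact ⟨P i, left_mem_segment _ _ _, left_mem_segment _ _ _⟩
    · exact ⟨P (finRotate n i), right_mem_segment _ _ _, left_mem_segment _ _ _⟩

lemma isConnected_boundary (hP : P.IsSimple) : IsConnected (P.boundary ℝ) :=
  ⟨⟨_, vertex_mem_boundary P ⟨0, by have := hP.three_le; lia⟩⟩, isPreconnected_boundary P⟩

lemma boundary_subset_closure_connectedComponentIn (hP : P.IsSimple) (hz : z ∉ P.boundary ℝ) :
    P.boundary ℝ ⊆ closure (connectedComponentIn (P.boundary ℝ)ᶜ z) :=
  subset_closure_connectedComponentIn (isClosed_boundary P) (isConnected_boundary hP)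
    (fun _ => twoSidedAt_boundary hP) hz

end Edges

section Jordan

variable {n : ℕ} {P : Polygon Plane n} {z z' : Plane}

lemma windingNumber_eq_of_mem_connectedComponentIn
    (hz' : z' ∈ connectedComponentIn (P.boundary ℝ)ᶜ z) :
    windingNumber P z' = windingNumber P z := by
  have hz : z ∈ (P.boundary ℝ)ᶜ := connectedComponentIn_nonempty_iff.1 ⟨z', hz'⟩
  exact windingNumber_eq_of_isPreconnected isPreconnected_connectedComponentIn
    (disjoint_left.2 fun _ hw => connectedComponentIn_subset _ _ hw) hz'
    (mem_connectedComponentIn hz)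

/-- Both sides of a point of the boundary are reached from every component, since every component
accumulates at that point. -/
lemma exists_connectedComponentIn_eq_or_eq (hP : P.IsSimple) :
    ∃ z₁ z₂, |windingNumber P z₁ - windingNumber P z₂| = 1 ∧ ∀ z ∉ P.boundary ℝ,
      connectedComponentIn (P.boundary ℝ)ᶜ z = connectedComponentIn (P.boundary ℝ)ᶜ z₁ ∨
      connectedComponentIn (P.boundary ℝ)ᶜ z = connectedComponentIn (P.boundary ℝ)ᶜ z₂ := by
  let i : Fin n := ⟨0, by have := hP.three_le; lia⟩
  have hne := vertex_ne_vertex_finRotate hP i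
  set m := midpoint ℝ (P i) (P (finRotate n i))
  have hm : m ∈ openSegment ℝ (P i) (P (finRotate n i)) := midpoint_mem_openSegment _ _
  have hmC : m ∈ P.boundary ℝ := mem_boundary_iff.2 ⟨i, openSegment_subset_segment _ _ _ hm⟩
  obtain ⟨B, S₁, S₂, hB, hmB, h₁, h₂, h, -, -⟩ := twoSidedAt_boundary hP hmC
  obtain ⟨d, hd⟩ := exists_linearIndependent_pair_of_one_lt_finrank (R := ℝ) (M := Plane)
    (by simp) (sub_ne_zero.2 hne.symm)
  have hnear : ∀ᶠ t in 𝓝 (0 : ℝ), m + t • d ∈ B :=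
    (tendsto_add_smul_nhds_zero m d).eventually (hB.mem_nhds hmB)
  obtain ⟨t, ⟨hoff, hoff', hjump⟩, ht, ht'⟩ := ((eventually_abs_windingNumber_sub_eq_one hm
    (fun j hj => notMem_edge_of_mem_openSegment_edge hP hj hm) hd).and
    ((hnear.filter_mono nhdsWithin_le_nhds).and
    ((tendsto_neg_nhdsGT_zero_nhdsNE.mono_right nhdsWithin_le_nhds).eventually hnear))).exists
  have hcases : ∀ z ∉ P.boundary ℝ, S₁ ⊆ connectedComponentIn (P.boundary ℝ)ᶜ z ∨
      S₂ ⊆ connectedComponentIn (P.boundary ℝ)ᶜ z := fun z hz =>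
    subset_connectedComponentIn_or_subset hB h₁ h₂ h hmB
      (boundary_subset_closure_connectedComponentIn hP hz hmC)
  have hconst : ∀ S, IsPreconnected S → S ⊆ S₁ ∪ S₂ →
      ¬ (m + t • d ∈ S ∧ m + (-t) • d ∈ S) := fun S hS hsub ⟨hmem, hmem'⟩ => by
    rw [windingNumber_eq_of_isPreconnected hS (disjoint_left.2 fun _ hw => (h.subset (hsub hw)).2)
      hmem hmem', sub_self, abs_zero] at hjump
    exact zero_ne_one hjump
  have hmem : m + t • d ∈ S₁ ∪ S₂ := h ▸ ⟨ht, hoff⟩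
  have hmem' : m + (-t) • d ∈ S₁ ∪ S₂ := h ▸ ⟨ht', hoff'⟩
  have hside := hconst S₁ h₁ subset_union_left
  have hside' := hconst S₂ h₂ subset_union_right
  refine ⟨m + t • d, m + (-t) • d, hjump, fun z hz => ?_⟩
  have heq {y} (hy : y ∈ connectedComponentIn (P.boundary ℝ)ᶜ z) := connectedComponentIn_eq hy
  rcases hmem with hmem | hmem <;> rcases hmem' with hmem' | hmem'
  · exact absurd ⟨hmem, hmem'⟩ hside
  · exact (hcases z hz).imp (fun hS => heq (hS hmem)) fun hS => heq (hS hmem')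
  · exact (hcases z hz).symm.imp (fun hS => heq (hS hmem)) fun hS => heq (hS hmem')
  · exact absurd ⟨hmem, hmem'⟩ hside'

lemma windingNumber_eq_of_connectedComponentIn_eq (hz : z ∉ P.boundary ℝ)
    (h : connectedComponentIn (P.boundary ℝ)ᶜ z = connectedComponentIn (P.boundary ℝ)ᶜ z') :
    windingNumber P z = windingNumber P z' :=
  windingNumber_eq_of_mem_connectedComponentIn (h ▸ mem_connectedComponentIn hz)

lemma connectedComponentIn_eq_of_windingNumber_eq (hP : P.IsSimple) (hz : z ∉ P.boundary ℝ)
    (hz' : z' ∉ P.boundary ℝ) (h : windingNumber P z = windingNumber P z') :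
    connectedComponentIn (P.boundary ℝ)ᶜ z = connectedComponentIn (P.boundary ℝ)ᶜ z' := by
  obtain ⟨z₁, z₂, hjump, hcases⟩ := exists_connectedComponentIn_eq_or_eq hP
  have hval {y y'} := windingNumber_eq_of_connectedComponentIn_eq (P := P) (z := y) (z' := y')
  have hne : windingNumber P z₁ ≠ windingNumber P z₂ := by
    intro h
    simp [h] at hjump
  rcases hcases z hz with h₁ | h₁ <;> rcases hcases z' hz' with h₂ | h₂
  · rw [h₁, h₂]
  · exact absurd ((hval hz h₁).symm.trans (h.trans (hval hz' h₂))) hne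
  · exact absurd ((hval hz' h₂).symm.trans (h.symm.trans (hval hz h₁))) hne
  · rw [h₁, h₂]

lemma abs_windingNumber_sub_le_one (hP : P.IsSimple) (hz : z ∉ P.boundary ℝ)
    (hz' : z' ∉ P.boundary ℝ) : |windingNumber P z - windingNumber P z'| ≤ 1 := by
  obtain ⟨z₁, z₂, hjump, hcases⟩ := exists_connectedComponentIn_eq_or_eq hP
  have heq {y} (hy : y ∉ P.boundary ℝ) : windingNumber P y = windingNumber P z₁ ∨
      windingNumber P y = windingNumber P z₂ :=
    (hcases y hy).imp (windingNumber_eq_of_connectedComponentIn_eq hy)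
      (windingNumber_eq_of_connectedComponentIn_eq hy)
  rcases heq hz with h | h <;> rcases heq hz' with h' | h' <;> rw [h, h']
  · simp
  · exact hjump.le
  · exact (abs_sub_comm _ _).trans_le hjump.le
  · simp

lemma windingNumber_eq_zero_of_mem_exterior (hz : z ∈ P.exterior) : windingNumber P z = 0 := by
  obtain ⟨R, hR⟩ := exists_windingNumber_eq_zero_of_norm_gt P
  obtain ⟨y, hy, hyR⟩ : ∃ y ∈ connectedComponentIn (P.boundary ℝ)ᶜ z, R < ‖y‖ := by
    by_contra! h
    exact hz.2 (isBounded_iff_forall_norm_le.2 ⟨R, h⟩)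
  rw [← windingNumber_eq_of_mem_connectedComponentIn hy, (hR y hyR).2]

lemma mem_exterior_iff_windingNumber_eq_zero (hP : P.IsSimple) (hz : z ∉ P.boundary ℝ) :
    z ∈ P.exterior ↔ windingNumber P z = 0 := by
  refine ⟨windingNumber_eq_zero_of_mem_exterior, fun h => ⟨hz, fun hbdd => ?_⟩⟩
  obtain ⟨R, hR⟩ := exists_windingNumber_eq_zero_of_norm_gt P
  obtain ⟨R', hR'⟩ := isBounded_iff_forall_norm_le.1 hbdd
  obtain ⟨y, hy⟩ := NormedSpace.exists_lt_norm ℝ Plane (max R R')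
  obtain ⟨hyC, hy0⟩ := hR y (lt_of_le_of_lt (le_max_left _ _) hy)
  have hmem : y ∈ connectedComponentIn (P.boundary ℝ)ᶜ z :=
    connectedComponentIn_eq_of_windingNumber_eq hP hz hyC (h.trans hy0.symm) ▸
      mem_connectedComponentIn hyC
  exact ((hR' y hmem).trans (le_max_right _ _)).not_gt hy

lemma abs_windingNumber_le_one (hP : P.IsSimple) (hz : z ∉ P.boundary ℝ) :
    |windingNumber P z| ≤ 1 := by
  obtain ⟨R, hR⟩ := exists_windingNumber_eq_zero_of_norm_gt P
  obtain ⟨y, hy⟩ := NormedSpace.exists_lt_norm ℝ Plane R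
  have h := abs_windingNumber_sub_le_one hP hz (hR y hy).1
  rwa [(hR y hy).2, sub_zero] at h

lemma exists_exterior_eq_connectedComponentIn (hP : P.IsSimple) :
    ∃ z ∉ P.boundary ℝ, P.exterior = connectedComponentIn (P.boundary ℝ)ᶜ z := by
  obtain ⟨R, hR⟩ := exists_windingNumber_eq_zero_of_norm_gt P
  obtain ⟨z, hz⟩ := NormedSpace.exists_lt_norm ℝ Plane R
  obtain ⟨hzC, hz0⟩ := hR z hz
  refine ⟨z, hzC, Subset.antisymm (fun y hy => ?_) fun y hy => ?_⟩
  · have hy0 := windingNumber_eq_zero_of_mem_exterior hy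
    exact connectedComponentIn_eq_of_windingNumber_eq hP hy.1 hzC (hy0.trans hz0.symm) ▸
      mem_connectedComponentIn hy.1
  · rw [mem_exterior_iff_windingNumber_eq_zero hP (connectedComponentIn_subset _ _ hy),
      windingNumber_eq_of_mem_connectedComponentIn hy, hz0]

lemma isPreconnected_exterior (hP : P.IsSimple) : IsPreconnected P.exterior := by
  obtain ⟨z, -, h⟩ := exists_exterior_eq_connectedComponentIn hP
  exact h ▸ isPreconnected_connectedComponentIn

lemma boundary_subset_closure_exterior (hP : P.IsSimple) :
    P.boundary ℝ ⊆ closure P.exterior := by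
  obtain ⟨z, hz, h⟩ := exists_exterior_eq_connectedComponentIn hP
  exact h ▸ boundary_subset_closure_connectedComponentIn hP hz

/-- The closed region bounded by a polygon, encoded as the complement of its exterior. -/
def body (P : Polygon Plane n) : Set Plane := P.exteriorᶜ

lemma boundary_subset_body (P : Polygon Plane n) : P.boundary ℝ ⊆ body P :=
  fun _ hz hext => hext.1 hz

lemma mem_body_iff_windingNumber_ne_zero (hP : P.IsSimple) (hz : z ∉ P.boundary ℝ) :
    z ∈ body P ↔ windingNumber P z ≠ 0 :=
  (mem_exterior_iff_windingNumber_eq_zero hP hz).not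

lemma isClosed_body (hP : P.IsSimple) : IsClosed (body P) := by
  obtain ⟨z, -, h⟩ := exists_exterior_eq_connectedComponentIn hP
  exact isClosed_compl_iff.2 (h ▸ (isClosed_boundary P).isOpen_compl.connectedComponentIn)

lemma mutuallyVisible_iff {p q : Plane} : P.MutuallyVisible p q ↔ segment ℝ p q ⊆ body P :=
  subset_compl_iff_disjoint_right.symm

end Jordan

section CyclicOrder

variable {n k : ℕ} {a b : Fin n}

lemma btw_finRotate (hab : a ≠ b) {w : Fin n} (h : btw a w b) (hwb : w ≠ b) :
    btw a (finRotate n w) b := by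
  have := w.2
  rw [Ne, Fin.ext_iff] at hab hwb
  rw [btw_iff_val] at h ⊢
  rw [val_finRotate]
  split_ifs <;> lia

lemma eq_or_eq_of_btw_of_btw {w : Fin n} (hab : a ≠ b) (h : btw a w b) (h' : btw b w a) :
    w = a ∨ w = b := by
  rcases h.antisymm h' with h | h | h
  · exact Or.inl h.symm
  · exact Or.inr h
  · exact absurd h.symm hab

lemma not_sbtw_finRotate (a w : Fin n) : ¬ sbtw a w (finRotate n a) := by
  rw [sbtw_iff_val, val_finRotate]
  split_ifs <;> lia

lemma sbtw_finRotate (hab : a ≠ b) (h : b ≠ finRotate n a) : sbtw a (finRotate n a) b := by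
  rw [Ne, Fin.ext_iff] at hab h
  rw [val_finRotate] at h
  rw [sbtw_iff_val, val_finRotate]
  split_ifs at h ⊢ <;> lia

lemma finRotate_eq_of_forall_not_sbtw (hab : a ≠ b) (h : ∀ w, ¬ sbtw a w b) :
    finRotate n a = b :=
  by_contra fun hne => h _ (sbtw_finRotate hab (Ne.symm hne))

lemma sbtw_map_iff {f : Fin k → Fin n} (hf : StrictMono f) {i j m : Fin k} :
    sbtw (f i) (f j) (f m) ↔ sbtw i j m := by
  simp only [sbtw_iff_val, Fin.val_fin_lt, hf.lt_iff_lt]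

end CyclicOrder

/-! ### Dividing a polygon along a diagonal -/

section Arc

variable {n k : ℕ} {a b : Fin n} {f : Fin k → Fin n}

/-- `f` lists the vertices of the boundary chain from `a` to `b`, endpoints included. They are
listed in increasing order, hence in their cyclic order, so that `f` need not start at `a`. -/
structure IsArc (a b : Fin n) (f : Fin k → Fin n) : Prop where
  strictMono : StrictMono f
  exists_apply_eq_iff : ∀ w, (∃ i, f i = w) ↔ btw a w b

lemma IsArc.btw_apply (hf : IsArc a b f) (i : Fin k) : btw a (f i) b :=
  (hf.exists_apply_eq_iff _).1 ⟨i, rfl⟩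

lemma IsArc.injective (hf : IsArc a b f) : Function.Injective f := hf.strictMono.injective

lemma IsArc.exists_apply_eq_left (hf : IsArc a b f) : ∃ i, f i = a :=
  (hf.exists_apply_eq_iff a).2 (btw_refl_left a b)

lemma IsArc.exists_apply_eq_right (hf : IsArc a b f) : ∃ i, f i = b :=
  (hf.exists_apply_eq_iff b).2 (btw_refl_right a b)

lemma IsArc.apply_finRotate_of_eq (hf : IsArc a b f) (hab : a ≠ b) {i : Fin k} (hi : f i = b) :
    f (finRotate k i) = a := by
  obtain ⟨j, hj⟩ := hf.exists_apply_eq_left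
  have hij : i ≠ j := fun h => hab (by rw [← hj, ← h, hi])
  rw [finRotate_eq_of_forall_not_sbtw hij fun m hm => ?_, hj]
  rw [← sbtw_map_iff hf.strictMono, hi, hj] at hm
  exact hm.not_btw (hf.btw_apply m)

lemma IsArc.apply_finRotate_of_ne (hf : IsArc a b f) (hab : a ≠ b) {i : Fin k} (hi : f i ≠ b) :
    f (finRotate k i) = finRotate n (f i) := by
  obtain ⟨j, hj⟩ := (hf.exists_apply_eq_iff _).2 (btw_finRotate hab (hf.btw_apply i) hi)
  have hn : 2 ≤ n := by
    have := a.2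
    have := b.2
    rw [Ne, Fin.ext_iff] at hab
    lia
  have hij : i ≠ j := fun h => finRotate_ne_self hn (f i) (by rw [← hj, h])
  rw [finRotate_eq_of_forall_not_sbtw hij fun m hm => ?_, hj]
  rw [← sbtw_map_iff hf.strictMono, hj] at hm
  exact not_sbtw_finRotate _ _ hm

end Arc

section Diagonal

variable {n : ℕ} {P : Polygon Plane n} {a b : Fin n} {z : Plane}

/-- A diagonal of a polygon: a chord whose relative interior misses the boundary. -/
structure IsDiagonal (P : Polygon Plane n) (a b : Fin n) : Prop where
  ne : a ≠ b
  ne_finRotate : b ≠ finRotate n a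
  ne_finRotate' : a ≠ finRotate n b
  disjoint_boundary : Disjoint (openSegment ℝ (P a) (P b)) (P.boundary ℝ)
  disjoint_exterior : Disjoint (openSegment ℝ (P a) (P b)) P.exterior

lemma IsDiagonal.symm (h : IsDiagonal P a b) : IsDiagonal P b a :=
  ⟨h.ne.symm, h.ne_finRotate', h.ne_finRotate, by rw [openSegment_symm]; exact h.disjoint_boundary,
    by rw [openSegment_symm]; exact h.disjoint_exterior⟩

lemma IsDiagonal.eq_or_eq_of_mem_boundary (hd : IsDiagonal P a b)
    (hz : z ∈ segment ℝ (P a) (P b)) (hzC : z ∈ P.boundary ℝ) : z = P a ∨ z = P b := by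
  rcases eq_or_eq_or_mem_openSegment_of_mem_segment hz with h | h | h
  · exact Or.inl h
  · exact Or.inr h
  · exact absurd hzC (disjoint_left.1 hd.disjoint_boundary h)

lemma IsDiagonal.segment_subset_body (hd : IsDiagonal P a b) :
    segment ℝ (P a) (P b) ⊆ body P := by
  intro z hz
  rcases eq_or_eq_or_mem_openSegment_of_mem_segment hz with rfl | rfl | h
  · exact boundary_subset_body _ (vertex_mem_boundary _ _)
  · exact boundary_subset_body _ (vertex_mem_boundary _ _)
  · exact disjoint_left.1 hd.disjoint_exterior h

lemma IsDiagonal.eq_endpoint_of_mem_edge (hP : P.IsSimple) (hd : IsDiagonal P a b) {w : Fin n}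
    (hz : z ∈ segment ℝ (P a) (P b)) (hw : z ∈ segment ℝ (P w) (P (finRotate n w))) :
    (z = P a ∧ (a = w ∨ a = finRotate n w)) ∨ (z = P b ∧ (b = w ∨ b = finRotate n w)) := by
  rcases hd.eq_or_eq_of_mem_boundary hz (mem_boundary_iff.2 ⟨w, hw⟩) with rfl | rfl
  · exact Or.inl ⟨rfl, eq_or_eq_finRotate_of_vertex_mem_edge hP hw⟩
  · exact Or.inr ⟨rfl, eq_or_eq_finRotate_of_vertex_mem_edge hP hw⟩

end Diagonal

section Reindex

variable {n k l : ℕ}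

/-- The polygon with vertices `P (f 0), P (f 1), …`; for an arc `f` from `a` to `b` this is the
part of `P` that is cut off by the segment from `P b` to `P a`. -/
def reindex (P : Polygon Plane n) (f : Fin k → Fin n) : Polygon Plane k := ⟨fun i => P (f i)⟩

@[simp] lemma reindex_apply (P : Polygon Plane n) (f : Fin k → Fin n) (i : Fin k) :
    reindex P f i = P (f i) := rfl

variable {P : Polygon Plane n} {a b : Fin n} {f : Fin k → Fin n} {g : Fin l → Fin n} {z : Plane}

lemma mem_boundary_reindex_iff (hf : IsArc a b f) (hab : a ≠ b) :
    z ∈ (reindex P f).boundary ℝ ↔ z ∈ segment ℝ (P a) (P b) ∨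
      ∃ w, btw a w b ∧ w ≠ b ∧ z ∈ segment ℝ (P w) (P (finRotate n w)) := by
  simp only [mem_boundary_iff, reindex_apply]
  constructor
  · rintro ⟨i, hi⟩
    by_cases hib : f i = b
    · rw [hf.apply_finRotate_of_eq hab hib, hib, segment_symm] at hi
      exact Or.inl hi
    · rw [hf.apply_finRotate_of_ne hab hib] at hi
      exact Or.inr ⟨f i, hf.btw_apply i, hib, hi⟩
  · rintro (hz | ⟨w, hw, hwb, hz⟩)
    · obtain ⟨i, hi⟩ := hf.exists_apply_eq_right
      refine ⟨i, ?_⟩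
      rwa [hf.apply_finRotate_of_eq hab hi, hi, segment_symm]
    · obtain ⟨i, rfl⟩ := (hf.exists_apply_eq_iff w).2 hw
      refine ⟨i, ?_⟩
      rwa [hf.apply_finRotate_of_ne hab hwb]

lemma boundary_subset_union (hf : IsArc a b f) (hg : IsArc b a g) (hab : a ≠ b) :
    P.boundary ℝ ⊆ (reindex P f).boundary ℝ ∪ (reindex P g).boundary ℝ := by
  intro z hz
  obtain ⟨w, hw⟩ := mem_boundary_iff.1 hz
  rw [mem_union, mem_boundary_reindex_iff hf hab, mem_boundary_reindex_iff hg hab.symm]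
  by_cases hwb : w = b
  · exact Or.inr (Or.inr ⟨w, hwb ▸ btw_refl_left b a, hwb ▸ hab.symm, hw⟩)
  by_cases hwa : w = a
  · exact Or.inl (Or.inr ⟨w, hwa ▸ btw_refl_left a b, hwb, hw⟩)
  rcases btw_total a w b with h | h
  · exact Or.inl (Or.inr ⟨w, h, hwb, hw⟩)
  · exact Or.inr (Or.inr ⟨w, h, hwa, hw⟩)

lemma boundary_reindex_subset (hf : IsArc a b f) (hab : a ≠ b) :
    (reindex P f).boundary ℝ ⊆ P.boundary ℝ ∪ segment ℝ (P a) (P b) := by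
  intro z hz
  rcases (mem_boundary_reindex_iff hf hab).1 hz with h | ⟨w, -, -, h⟩
  · exact Or.inr h
  · exact Or.inl (mem_boundary_iff.2 ⟨w, h⟩)

lemma segment_subset_boundary_reindex (hf : IsArc a b f) (hab : a ≠ b) :
    segment ℝ (P a) (P b) ⊆ (reindex P f).boundary ℝ :=
  fun _ hz => (mem_boundary_reindex_iff hf hab).2 (Or.inl hz)

open Classical in
lemma IsArc.sum_comp {M : Type*} [AddCommMonoid M] (hf : IsArc a b f) (θ : Fin n → M) :
    ∑ i, θ (f i) = ∑ w with btw a w b, θ w := by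
  have himage : Finset.univ.image f = Finset.univ.filter fun w => btw a w b := by
    ext w
    simp [hf.exists_apply_eq_iff]
  rw [← himage, Finset.sum_image hf.injective.injOn]

open Classical in
lemma windingNumber_reindex (hf : IsArc a b f) (hab : a ≠ b) (z : Plane) :
    windingNumber (reindex P f) z = (visualAngle (P b) (P a) z +
      ∑ w with btw a w b ∧ w ≠ b, visualAngle (P w) (P (finRotate n w)) z) / (2 * Real.pi) := by
  have hedge (i : Fin k) : visualAngle (P (f i)) (P (f (finRotate k i))) z =
      if f i = b then visualAngle (P b) (P a) z
      else visualAngle (P (f i)) (P (finRotate n (f i))) z := by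
    split_ifs with hib
    · rw [hf.apply_finRotate_of_eq hab hib, hib]
    · rw [hf.apply_finRotate_of_ne hab hib]
  have hb : Finset.univ.filter (fun w => btw a w b ∧ w = b) = {b} := by
    ext w
    simpa using fun h : w = b => h ▸ btw_refl_right a b
  simp only [windingNumber, reindex_apply, hedge]
  rw [hf.sum_comp fun w => if w = b then visualAngle (P b) (P a) z
      else visualAngle (P w) (P (finRotate n w)) z, Finset.sum_ite, Finset.filter_filter,
    Finset.filter_filter, hb, Finset.sum_singleton]

lemma windingNumber_eq_add (hf : IsArc a b f) (hg : IsArc b a g) (hab : a ≠ b)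
    (hz : z ∉ segment ℝ (P a) (P b)) :
    windingNumber P z = windingNumber (reindex P f) z + windingNumber (reindex P g) z := by
  classical
  have hchain (w : Fin n) : ¬ (btw a w b ∧ w ≠ b) ↔ btw b w a ∧ w ≠ a := by
    rw [Ne, Fin.ext_iff] at hab
    rw [btw_iff_val, btw_iff_val, Ne, Ne, Fin.ext_iff, Fin.ext_iff]
    lia
  rw [windingNumber_reindex hf hab, windingNumber_reindex hg hab.symm, windingNumber,
    ← Finset.sum_filter_add_sum_filter_not Finset.univ fun w => btw a w b ∧ w ≠ b]
  simp only [hchain]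
  rw [← add_div, add_add_add_comm, add_comm (visualAngle _ _ _), visualAngle_add_swap hz, zero_add]

end Reindex

section Divide

variable {n k l : ℕ} {P : Polygon Plane n} {a b : Fin n} {f : Fin k → Fin n} {g : Fin l → Fin n}
  {z : Plane}

lemma isSimple_of_forall_mem_edge (hn : 3 ≤ n) (hinj : Function.Injective P.vertices)
    (h : ∀ i j z, i ≠ j → z ∈ segment ℝ (P i) (P (finRotate n i)) →
      z ∈ segment ℝ (P j) (P (finRotate n j)) →
      (j = finRotate n i ∧ z = P j) ∨ (i = finRotate n j ∧ z = P i)) : P.IsSimple := by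
  refine ⟨hn, hinj, fun i => ?_, fun i j hji hij hij' => ?_⟩ <;>
    rw [edgeSet, edgeSet, affineSegment_eq_segment, affineSegment_eq_segment]
  · refine Subset.antisymm (fun z hz => ?_) ?_
    · rcases h i (finRotate n i) z (finRotate_ne_self (by lia) i).symm hz.1 hz.2 with
        ⟨-, hz⟩ | ⟨hi, -⟩
      · exact hz
      · rw [Fin.ext_iff, val_finRotate, val_finRotate] at hi
        split_ifs at hi <;> lia
    · exact singleton_subset_iff.2 ⟨right_mem_segment _ _ _, left_mem_segment _ _ _⟩
  · refine disjoint_left.2 fun z hz hz' => ?_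
    rcases h i j z hji.symm hz hz' with ⟨h, -⟩ | ⟨h, -⟩
    · exact hij h
    · exact hij' h

lemma IsDiagonal.three_le_of_isArc (hP : P.IsSimple) (hd : IsDiagonal P a b) (hf : IsArc a b f) :
    3 ≤ k := by
  obtain ⟨i, hi⟩ := hf.exists_apply_eq_left
  obtain ⟨j, hj⟩ := hf.exists_apply_eq_right
  obtain ⟨m, hm⟩ := (hf.exists_apply_eq_iff _).2 (btw_finRotate hd.ne (btw_refl_left a b) hd.ne)
  rw [← Fintype.card_fin k]
  refine Fintype.two_lt_card_iff.2 ⟨i, j, m, ?_, ?_, ?_⟩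
  · rintro rfl
    exact hd.ne (hi.symm.trans hj)
  · rintro rfl
    exact finRotate_ne_self (by have := hP.three_le; lia) a (hm.symm.trans hi)
  · rintro rfl
    exact hd.ne_finRotate (hj.symm.trans hm)

lemma IsDiagonal.eq_finRotate_of_mem_edges (hP : P.IsSimple) (hd : IsDiagonal P a b)
    (hf : IsArc a b f) {i j : Fin k} (hi : f i = b) (hij : i ≠ j)
    (hz : z ∈ segment ℝ (P (f i)) (P (f (finRotate k i))))
    (hz' : z ∈ segment ℝ (P (f j)) (P (f (finRotate k j)))) :
    (j = finRotate k i ∧ z = P (f j)) ∨ (i = finRotate k j ∧ z = P (f i)) := by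
  have hjb : f j ≠ b := fun h => hij (hf.injective (hi.trans h.symm))
  have hroti := hf.apply_finRotate_of_eq hd.ne hi
  have hrotj := hf.apply_finRotate_of_ne hd.ne hjb
  rw [hi, hroti, segment_symm] at hz
  rw [hrotj] at hz'
  rcases hd.eq_endpoint_of_mem_edge hP hz hz' with ⟨rfl, h | h⟩ | ⟨rfl, h | h⟩
  · exact Or.inl ⟨hf.injective (h.symm.trans hroti.symm), by rw [← h]⟩
  · exact absurd ((finRotate k).injective (hf.injective (hroti.trans (h.trans hrotj.symm)))) hij
  · exact absurd h.symm hjb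
  · exact Or.inr ⟨hf.injective (hi.trans (h.trans hrotj.symm)), by rw [hi]⟩

lemma IsDiagonal.isSimple_reindex (hP : P.IsSimple) (hd : IsDiagonal P a b) (hf : IsArc a b f) :
    (reindex P f).IsSimple := by
  refine isSimple_of_forall_mem_edge (hd.three_le_of_isArc hP hf)
    (fun i j h => hf.injective (hP.injective h)) fun i j z hij hz hz' => ?_
  simp only [reindex_apply] at hz hz' ⊢
  by_cases hib : f i = b
  · exact hd.eq_finRotate_of_mem_edges hP hf hib hij hz hz'
  by_cases hjb : f j = b
  · exact (hd.eq_finRotate_of_mem_edges hP hf hjb hij.symm hz' hz).symm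
  have hroti := hf.apply_finRotate_of_ne hd.ne hib
  have hrotj := hf.apply_finRotate_of_ne hd.ne hjb
  rw [hroti] at hz
  rw [hrotj] at hz'
  rcases eq_vertex_of_mem_edge_of_mem_edge hP (hf.injective.ne hij) hz hz' with ⟨h, h'⟩ | ⟨h, h'⟩
  · exact Or.inl ⟨hf.injective (h.trans hroti.symm), h'⟩
  · exact Or.inr ⟨hf.injective (h.trans hrotj.symm), h'⟩

lemma IsDiagonal.exterior_subset_exterior_reindex (hP : P.IsSimple) (hd : IsDiagonal P a b)
    (hf : IsArc a b f) : P.exterior ⊆ (reindex P f).exterior := by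
  have hdisj : Disjoint P.exterior ((reindex P f).boundary ℝ) := by
    refine disjoint_left.2 fun z hz hz' => ?_
    rcases boundary_reindex_subset hf hd.ne hz' with h | h
    · exact hz.1 h
    · exact hd.segment_subset_body h hz
  obtain ⟨R, hR⟩ := exists_windingNumber_eq_zero_of_norm_gt P
  obtain ⟨R', hR'⟩ := exists_windingNumber_eq_zero_of_norm_gt (reindex P f)
  obtain ⟨y, hy⟩ := NormedSpace.exists_lt_norm ℝ Plane (max R R')
  obtain ⟨hyC, hy0⟩ := hR y ((le_max_left _ _).trans_lt hy)
  have hyext := (mem_exterior_iff_windingNumber_eq_zero hP hyC).2 hy0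
  intro z hz
  rw [mem_exterior_iff_windingNumber_eq_zero (hd.isSimple_reindex hP hf) (disjoint_left.1 hdisj hz),
    ← (hR' y ((le_max_right _ _).trans_lt hy)).2]
  exact windingNumber_eq_of_isPreconnected (isPreconnected_exterior hP) hdisj hz hyext

lemma IsDiagonal.body_reindex_subset (hP : P.IsSimple) (hd : IsDiagonal P a b)
    (hf : IsArc a b f) : body (reindex P f) ⊆ body P :=
  compl_subset_compl.2 (hd.exterior_subset_exterior_reindex hP hf)

lemma IsDiagonal.mem_boundary_reindex_of_mem_body (hP : P.IsSimple) (hd : IsDiagonal P a b)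
    (hf : IsArc a b f) (hz : z ∈ P.boundary ℝ) (hzf : z ∈ body (reindex P f)) :
    z ∈ (reindex P f).boundary ℝ := by
  by_contra hzC
  obtain ⟨y, hy, hyext⟩ := mem_closure_iff.1 (boundary_subset_closure_exterior hP hz) _
    (isClosed_boundary (reindex P f)).isOpen_compl.connectedComponentIn
    (mem_connectedComponentIn hzC)
  apply (mem_body_iff_windingNumber_ne_zero (hd.isSimple_reindex hP hf) hzC).1 hzf
  rw [← windingNumber_eq_of_mem_connectedComponentIn hy]
  exact windingNumber_eq_zero_of_mem_exterior (hd.exterior_subset_exterior_reindex hP hf hyext)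

lemma mem_segment_of_mem_boundary_reindex (hP : P.IsSimple) (hab : a ≠ b)
    (hf : IsArc a b f) (hg : IsArc b a g) (hzf : z ∈ (reindex P f).boundary ℝ)
    (hzg : z ∈ (reindex P g).boundary ℝ) : z ∈ segment ℝ (P a) (P b) := by
  have hvertex {v : Fin n} (h : btw a v b) (h' : btw b v a) : P v ∈ segment ℝ (P a) (P b) := by
    rcases eq_or_eq_of_btw_of_btw hab h h' with rfl | rfl
    · exact left_mem_segment _ _ _
    · exact right_mem_segment _ _ _
  rcases (mem_boundary_reindex_iff hf hab).1 hzf with hz | ⟨w, hw, hwb, hz⟩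
  · exact hz
  rcases (mem_boundary_reindex_iff hg hab.symm).1 hzg with hz' | ⟨w', hw', hwa', hz'⟩
  · rwa [segment_symm]
  have hne : w ≠ w' := by
    rintro rfl
    exact (eq_or_eq_of_btw_of_btw hab hw hw').elim hwa' hwb
  rcases eq_vertex_of_mem_edge_of_mem_edge hP hne hz hz' with ⟨rfl, rfl⟩ | ⟨rfl, rfl⟩
  · exact hvertex (btw_finRotate hab hw hwb) hw'
  · exact hvertex hw (btw_finRotate hab.symm hw' hwa')

lemma IsDiagonal.body_reindex_inter_subset (hP : P.IsSimple) (hd : IsDiagonal P a b)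
    (hf : IsArc a b f) (hg : IsArc b a g) :
    body (reindex P f) ∩ body (reindex P g) ⊆ segment ℝ (P a) (P b) := by
  rintro z ⟨hzf, hzg⟩
  by_contra hz
  by_cases hzC : z ∈ P.boundary ℝ
  · exact hz (mem_segment_of_mem_boundary_reindex hP hd.ne hf hg
      (hd.mem_boundary_reindex_of_mem_body hP hf hzC hzf)
      (hd.symm.mem_boundary_reindex_of_mem_body hP hg hzC hzg))
  have hzCf : z ∉ (reindex P f).boundary ℝ := fun h =>
    (boundary_reindex_subset hf hd.ne h).elim hzC hz
  have hzCg : z ∉ (reindex P g).boundary ℝ := fun h =>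
    (boundary_reindex_subset hg hd.ne.symm h).elim hzC (by rwa [segment_symm])
  have hR := hd.isSimple_reindex hP hf
  have hR' := hd.symm.isSimple_reindex hP hg
  have hle := abs_windingNumber_le_one hP hzC
  have hlef := abs_windingNumber_le_one hR hzCf
  have hleg := abs_windingNumber_le_one hR' hzCg
  have hnef := (mem_body_iff_windingNumber_ne_zero hR hzCf).1 hzf
  have hneg := (mem_body_iff_windingNumber_ne_zero hR' hzCg).1 hzg
  have hne := (mem_body_iff_windingNumber_ne_zero hP hzC).1 (hd.body_reindex_subset hP hf hzf)
  rw [windingNumber_eq_add hf hg hd.ne hz] at hle hne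
  obtain ⟨r, hr⟩ := exists_int_eq_windingNumber hzCf
  obtain ⟨s, hs⟩ := exists_int_eq_windingNumber hzCg
  rw [hr, abs_le] at hlef
  rw [hs, abs_le] at hleg
  rw [hr, hs, abs_le] at hle
  rw [hr] at hnef hne
  rw [hs] at hneg hne
  norm_cast at hlef hleg hle hnef hneg hne
  lia

lemma IsDiagonal.body_subset_union (hP : P.IsSimple) (hd : IsDiagonal P a b) (hf : IsArc a b f)
    (hg : IsArc b a g) : body P ⊆ body (reindex P f) ∪ body (reindex P g) := by
  intro z hz
  by_cases hzs : z ∈ segment ℝ (P a) (P b)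
  · exact Or.inl (boundary_subset_body _ (segment_subset_boundary_reindex hf hd.ne hzs))
  by_cases hzC : z ∈ P.boundary ℝ
  · exact (boundary_subset_union hf hg hd.ne hzC).imp (fun h => boundary_subset_body _ h)
      fun h => boundary_subset_body _ h
  by_contra hcon
  rw [mem_union, not_or, body, body, notMem_compl_iff, notMem_compl_iff] at hcon
  refine hz ((mem_exterior_iff_windingNumber_eq_zero hP hzC).2 ?_)
  rw [windingNumber_eq_add hf hg hd.ne hzs, windingNumber_eq_zero_of_mem_exterior hcon.1,
    windingNumber_eq_zero_of_mem_exterior hcon.2, add_zero]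

lemma IsDiagonal.segment_inter_nonempty (hP : P.IsSimple) (hd : IsDiagonal P a b)
    (hf : IsArc a b f) (hg : IsArc b a g) {p q : Plane} (hp : p ∈ body (reindex P f))
    (hq : q ∈ body (reindex P g)) (hpq : segment ℝ p q ⊆ body P) :
    (segment ℝ p q ∩ segment ℝ (P a) (P b)).Nonempty := by
  obtain ⟨z, hz, hzfg⟩ := isPreconnected_closed_iff.1 (convex_segment p q).isPreconnected _ _
    (isClosed_body (hd.isSimple_reindex hP hf)) (isClosed_body (hd.symm.isSimple_reindex hP hg))
    (hpq.trans (hd.body_subset_union hP hf hg)) ⟨p, left_mem_segment _ _ _, hp⟩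
    ⟨q, right_mem_segment _ _ _, hq⟩
  exact ⟨z, hz, hd.body_reindex_inter_subset hP hf hg hzfg⟩

lemma IsDiagonal.segment_subset_body_reindex (hP : P.IsSimple) (hd : IsDiagonal P a b)
    (hf : IsArc a b f) (hg : IsArc b a g) {p q : Plane} (hp : p ∈ body (reindex P f))
    (hq : q ∈ body (reindex P f)) (hpq : segment ℝ p q ⊆ body P) :
    segment ℝ p q ⊆ body (reindex P f) := by
  intro z hz
  rcases hd.body_subset_union hP hf hg (hpq hz) with hzf | hzg
  · exact hzf
  by_contra hzf
  have hzs : z ∉ segment ℝ (P a) (P b) := fun h =>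
    hzf (boundary_subset_body _ (segment_subset_boundary_reindex hf hd.ne h))
  have hpz : segment ℝ p z ⊆ segment ℝ p q :=
    (convex_segment p q).segment_subset (left_mem_segment _ _ _) hz
  have hqz : segment ℝ q z ⊆ segment ℝ p q :=
    (convex_segment p q).segment_subset (right_mem_segment _ _ _) hz
  obtain ⟨x, hx, hxs⟩ := hd.segment_inter_nonempty hP hf hg hp hzg (hpz.trans hpq)
  obtain ⟨y, hy, hys⟩ := hd.segment_inter_nonempty hP hf hg hq hzg (hqz.trans hpq)
  refine hzs ((convex_segment (P a) (P b)).segment_subset hys hxs ?_)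
  rw [mem_segment_iff_wbtw] at hx hy hz ⊢
  exact (hz.trans_left_right hx).symm.trans_left_right hy

end Divide

/-! ### Existence of a diagonal -/

section Segment

variable {E : Type*} [AddCommGroup E] [Module ℝ E]

lemma mem_openSegment_of_mem_segment_of_mem_segment {p q x z : E} (hz : z ∈ segment ℝ p q)
    (hx : x ∈ segment ℝ z q) (hxz : x ≠ z) (hxq : x ≠ q) : x ∈ openSegment ℝ p q := by
  rw [mem_segment_iff_wbtw] at hz hx
  have hsbtw := hz.trans_sbtw_right ⟨hx, hxz, hxq⟩
  rcases eq_or_eq_or_mem_openSegment_of_mem_segment (mem_segment_iff_wbtw.2 hsbtw.wbtw) with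
    h | h | h
  · exact absurd h hsbtw.ne_left
  · exact absurd h hxq
  · exact h

end Segment

section NormedSegment

variable {E : Type*} [NormedAddCommGroup E] [NormedSpace ℝ E]

lemma le_or_le_of_mem_segment {p q z : E} (L : E →L[ℝ] ℝ) (hz : z ∈ segment ℝ p q) :
    L p ≤ L z ∨ L q ≤ L z := by
  by_contra! h
  have hlt : L z < L z := (convex_halfSpace_gt L.isLinear (L z)).segment_subset h.1 h.2 hz
  exact hlt.false

lemma eq_left_of_mem_segment {p q z : E} (L : E →L[ℝ] ℝ) (hz : z ∈ segment ℝ p q)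
    (hzp : L z ≤ L p) (hpq : L p < L q) : z = p := by
  rcases eq_or_eq_or_mem_openSegment_of_mem_segment hz with h | rfl | h
  · exact h
  · exact absurd hpq hzp.not_gt
  · obtain ⟨t, ⟨ht, -⟩, rfl⟩ := mem_openSegment_iff_exists_add_smul.1 h
    rw [map_add, map_smul, map_sub, smul_eq_mul] at hzp
    nlinarith

lemma norm_lt_norm_of_mem_openSegment [StrictConvexSpace ℝ E] {p x v : E} (hpx : p ≠ x)
    (hv : v ∈ openSegment ℝ p x) (hp : ‖p‖ ≤ ‖v‖) : ‖v‖ < ‖x‖ := by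
  by_contra! hx
  have hball := openSegment_subset_ball_of_ne (mem_closedBall_zero_iff.2 hp)
    (mem_closedBall_zero_iff.2 hx) hpx hv
  exact lt_irrefl _ (mem_ball_zero_iff.1 hball)

lemma norm_lt_norm_add_smul_sub [StrictConvexSpace ℝ E] {p v : E} (hpv : p ≠ v)
    (hp : ‖p‖ ≤ ‖v‖) {t : ℝ} (ht : 0 < t) : ‖v‖ < ‖v + t • (v - p)‖ := by
  have hsub : v + t • (v - p) - p = (1 + t) • (v - p) := by module
  refine norm_lt_norm_of_mem_openSegment (p := p) (fun h => ?_) ?_ hp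
  · rw [← h, sub_self, eq_comm, smul_eq_zero, sub_eq_zero] at hsub
    exact hsub.elim (by positivity) (hpv ·.symm)
  · refine mem_openSegment_iff_exists_add_smul.2 ⟨(1 + t)⁻¹,
      ⟨by positivity, inv_lt_one_of_one_lt₀ (by linarith)⟩, ?_⟩
    rw [hsub, inv_smul_smul₀ (by positivity), add_sub_cancel]

end NormedSegment

section CornerFrame

variable {n : ℕ} {P : Polygon Plane n} {i j k : Fin n} {A B : Plane →L[ℝ] ℝ} {c : ℝ} {z : Plane}

lemma norm_le_of_mem_boundary {M : ℝ} (hM : ∀ j, ‖P j‖ ≤ M) (hz : z ∈ P.boundary ℝ) :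
    ‖z‖ ≤ M := by
  obtain ⟨j, hj⟩ := mem_boundary_iff.1 hz
  exact mem_closedBall_zero_iff.1 ((convex_closedBall (0 : Plane) M).segment_subset
    (mem_closedBall_zero_iff.2 (hM _)) (mem_closedBall_zero_iff.2 (hM _)) hj)

lemma windingNumber_add_smul_eq_zero {d : Plane} (hd : d ≠ 0)
    (h : ∀ t : ℝ, 0 < t → z + t • d ∉ P.boundary ℝ) {t : ℝ} (ht : 0 < t) :
    windingNumber P (z + t • d) = 0 := by
  obtain ⟨R, hR⟩ := exists_windingNumber_eq_zero_of_norm_gt P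
  obtain ⟨s, hs, hsR⟩ : ∃ s : ℝ, 0 < s ∧ R < ‖z + s • d‖ := by
    have hlim : Tendsto (fun s : ℝ => s * ‖d‖ - ‖z‖) atTop atTop :=
      tendsto_atTop_add_const_right _ _ (tendsto_id.atTop_mul_const (norm_pos_iff.2 hd))
    obtain ⟨s, hs, hsR⟩ := ((eventually_gt_atTop 0).and (hlim.eventually_gt_atTop R)).exists
    refine ⟨s, hs, hsR.trans_le ?_⟩
    have hnorm := norm_sub_norm_le (s • d) (-z)
    rwa [sub_neg_eq_add, norm_neg, norm_smul, Real.norm_of_nonneg hs.le, add_comm (s • d)] at hnorm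
  rw [← (hR _ hsR).2]
  refine windingNumber_eq_of_isPreconnected (S := (fun t : ℝ => z + t • d) '' Ioi 0)
    (isPreconnected_Ioi.image _ (by fun_prop)) ?_ (mem_image_of_mem _ ht) (mem_image_of_mem _ hs)
  rw [disjoint_left]
  rintro _ ⟨s, hs, rfl⟩
  exact h s hs

/-- Linear coordinates `A`, `B` of the plane which, with the vertex `P (finRotate n i)` as the
origin, take the values `(1, 0)` and `(0, 1)` at its two neighbours on the boundary. -/
structure IsCornerFrame (P : Polygon Plane n) (i : Fin n) (A B : Plane →L[ℝ] ℝ) : Prop where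
  fst_prev : A (P i - P (finRotate n i)) = 1
  snd_prev : B (P i - P (finRotate n i)) = 0
  fst_next : A (P (finRotate n (finRotate n i)) - P (finRotate n i)) = 0
  snd_next : B (P (finRotate n (finRotate n i)) - P (finRotate n i)) = 1
  eq_add : ∀ x, x = A x • (P i - P (finRotate n i)) +
    B x • (P (finRotate n (finRotate n i)) - P (finRotate n i))

/-- The open triangle at the vertex `P (finRotate n i)` which the line `A + B = c` cuts off from
the angle spanned by the two edges; for `c = 1` the third side joins the two neighbours. -/
def openCorner (P : Polygon Plane n) (i : Fin n) (A B : Plane →L[ℝ] ℝ) (c : ℝ) : Set Plane :=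
  {z | 0 < A (z - P (finRotate n i)) ∧ 0 < B (z - P (finRotate n i)) ∧
    A (z - P (finRotate n i)) + B (z - P (finRotate n i)) < c}

lemma convex_openCorner : Convex ℝ (openCorner P i A B c) := by
  have h : openCorner P i A B c = {z | A (P (finRotate n i)) < A z} ∩
      {z | B (P (finRotate n i)) < B z} ∩
      {z | (A + B) z < c + (A + B) (P (finRotate n i))} := by
    ext z
    simp only [openCorner, map_sub, sub_pos, mem_ofPred_eq, mem_inter_iff, add_apply, and_assoc]
    refine and_congr_right' (and_congr_right' ⟨fun h => by linarith, fun h => by linarith⟩)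
  rw [h]
  exact ((convex_halfSpace_gt A.isLinear _).inter (convex_halfSpace_gt B.isLinear _)).inter
    (convex_halfSpace_lt (A + B).isLinear _)

lemma IsCornerFrame.mem_edge_iff (h : IsCornerFrame P i A B) :
    z ∈ segment ℝ (P i) (P (finRotate n i)) ↔
      A (z - P (finRotate n i)) ∈ Icc 0 1 ∧ B (z - P (finRotate n i)) = 0 := by
  rw [segment_symm]
  exact mem_segment_iff_of_coordinates h.fst_prev h.snd_prev h.eq_add

lemma IsCornerFrame.mem_edge_finRotate_iff (h : IsCornerFrame P i A B) :
    z ∈ segment ℝ (P (finRotate n i)) (P (finRotate n (finRotate n i))) ↔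
      B (z - P (finRotate n i)) ∈ Icc 0 1 ∧ A (z - P (finRotate n i)) = 0 :=
  mem_segment_iff_of_coordinates h.snd_next h.fst_next fun x => (h.eq_add x).trans (add_comm _ _)

lemma IsCornerFrame.ne_of_mem_edge (h : IsCornerFrame P i A B)
    (hz : z ∈ segment ℝ (P j) (P (finRotate n j))) (hA : 0 < A (z - P (finRotate n i)))
    (hB : 0 < B (z - P (finRotate n i))) : j ≠ i ∧ j ≠ finRotate n i := by
  constructor
  · rintro rfl
    exact hB.ne' (h.mem_edge_iff.1 hz).2
  · rintro rfl
    exact hA.ne' (h.mem_edge_finRotate_iff.1 hz).2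

/-- Otherwise the edge would leave the angle through one of the two edges that span it. -/
lemma IsCornerFrame.nonneg_of_mem_edge (hP : P.IsSimple) (h : IsCornerFrame P i A B)
    (hz : z ∈ segment ℝ (P j) (P (finRotate n j))) (hA : 0 < A (z - P (finRotate n i)))
    (hB : 0 < B (z - P (finRotate n i)))
    (hAB : A (z - P (finRotate n i)) + B (z - P (finRotate n i)) ≤ 1)
    (hk : k = j ∨ k = finRotate n j)
    (hkAB : A (P k - P (finRotate n i)) + B (P k - P (finRotate n i)) ≤ 1) :
    0 ≤ A (P k - P (finRotate n i)) ∧ 0 ≤ B (P k - P (finRotate n i)) := by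
  set v := P (finRotate n i)
  by_contra hneg
  obtain ⟨x, hxz, hx0⟩ : (0 : ℝ) ∈ (fun y => min (A (y - v)) (B (y - v))) '' segment ℝ z (P k) := by
    refine (convex_segment z (P k)).isPreconnected.intermediate_value (right_mem_segment _ _ _)
      (left_mem_segment _ _ _) (by fun_prop) ⟨?_, (lt_min hA hB).le⟩
    exact (not_le.1 fun hle => hneg (le_min_iff.1 hle)).le
  obtain ⟨hxA, hxB⟩ : 0 ≤ A (x - v) ∧ 0 ≤ B (x - v) := le_min_iff.1 hx0.ge
  have hxAB : A (x - v) + B (x - v) ≤ 1 := by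
    rw [← add_apply, map_sub, sub_le_iff_le_add] at *
    exact (convex_halfSpace_le (A + B).isLinear _).segment_subset hAB hkAB hxz
  have hxne : x ≠ z := fun he => (lt_min hA hB).ne' (he ▸ hx0)
  have hxne' : x ≠ P k := fun he => hneg (he ▸ ⟨hxA, hxB⟩)
  have hxopen : x ∈ openSegment ℝ (P j) (P (finRotate n j)) := by
    rcases hk with rfl | rfl
    · rw [segment_symm] at hz
      rw [openSegment_symm]
      exact mem_openSegment_of_mem_segment_of_mem_segment hz hxz hxne hxne'
    · exact mem_openSegment_of_mem_segment_of_mem_segment hz hxz hxne hxne'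
  obtain ⟨hji, hji'⟩ := h.ne_of_mem_edge hz hA hB
  rcases min_eq_iff.1 hx0 with ⟨hA0, -⟩ | ⟨hB0, -⟩
  · exact notMem_edge_of_mem_openSegment_edge hP hji'.symm hxopen
      (h.mem_edge_finRotate_iff.2 ⟨⟨hxB, by linarith⟩, hA0⟩)
  · exact notMem_edge_of_mem_openSegment_edge hP hji.symm hxopen
      (h.mem_edge_iff.2 ⟨⟨hxA, by linarith⟩, hB0⟩)

lemma IsCornerFrame.disjoint_openCorner_boundary (hP : P.IsSimple) (h : IsCornerFrame P i A B)
    (hc : c ≤ 1) (hvert : ∀ k, k ≠ finRotate n i → 0 ≤ A (P k - P (finRotate n i)) →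
      0 ≤ B (P k - P (finRotate n i)) →
      c ≤ A (P k - P (finRotate n i)) + B (P k - P (finRotate n i))) :
    Disjoint (openCorner P i A B c) (P.boundary ℝ) := by
  refine disjoint_left.2 fun z ⟨hA, hB, hAB⟩ hz => ?_
  obtain ⟨j, hj⟩ := mem_boundary_iff.1 hz
  obtain ⟨hji, hji'⟩ := h.ne_of_mem_edge hj hA hB
  obtain ⟨k, hk, hkAB⟩ : ∃ k, (k = j ∨ k = finRotate n j) ∧ (A + B) (P k) ≤ (A + B) z :=
    (le_or_le_of_mem_segment (A + B) hj).elim (fun h => ⟨j, Or.inl rfl, h⟩)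
      fun h => ⟨_, Or.inr rfl, h⟩
  have hki : k ≠ finRotate n i := by
    rcases hk with rfl | rfl
    · exact hji'
    · exact (finRotate n).injective.ne hji
  have hkAB' : A (P k - P (finRotate n i)) + B (P k - P (finRotate n i)) < c := by
    simp only [map_sub, add_apply] at hAB hkAB ⊢
    linarith
  obtain ⟨hkA, hkB⟩ := h.nonneg_of_mem_edge hP hj hA hB (hAB.le.trans hc) hk (hkAB'.le.trans hc)
  exact (hvert k hki hkA hkB).not_gt hkAB'

lemma IsCornerFrame.pos_of_nonneg (hP : P.IsSimple) (h : IsCornerFrame P i A B) (hki : k ≠ i)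
    (hki' : k ≠ finRotate n i) (hki'' : k ≠ finRotate n (finRotate n i))
    (hA : 0 ≤ A (P k - P (finRotate n i))) (hB : 0 ≤ B (P k - P (finRotate n i)))
    (hAB : A (P k - P (finRotate n i)) + B (P k - P (finRotate n i)) ≤ 1) :
    0 < A (P k - P (finRotate n i)) ∧ 0 < B (P k - P (finRotate n i)) := by
  refine ⟨hA.lt_of_ne' fun hA0 => ?_, hB.lt_of_ne' fun hB0 => ?_⟩
  · exact (eq_or_eq_finRotate_of_vertex_mem_edge hP
      (h.mem_edge_finRotate_iff.2 ⟨⟨hB, by linarith⟩, hA0⟩)).elim hki' hki''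
  · exact (eq_or_eq_finRotate_of_vertex_mem_edge hP
      (h.mem_edge_iff.2 ⟨⟨hA, by linarith⟩, hB0⟩)).elim hki hki'

lemma IsCornerFrame.linearIndependent (h : IsCornerFrame P i A B) :
    LinearIndependent ℝ ![P (finRotate n i) - P i,
      P (finRotate n (finRotate n i)) - P (finRotate n i)] := by
  refine LinearIndependent.pair_iff.2 fun s t hst => ?_
  rw [← neg_sub (P i)] at hst
  have hA := congrArg A hst
  have hB := congrArg B hst
  simp only [map_add, map_smul, map_neg, h.fst_prev, h.fst_next, h.snd_prev, h.snd_next,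
    map_zero, smul_eq_mul] at hA hB
  exact ⟨by linarith, by linarith⟩

lemma exists_isCornerFrame_of_norm_le (hP : P.IsSimple)
    (hmax : ∀ j, ‖P j‖ ≤ ‖P (finRotate n i)‖) : ∃ A B, IsCornerFrame P i A B := by
  have hli : LinearIndependent ℝ ![P i - P (finRotate n i),
      P (finRotate n (finRotate n i)) - P (finRotate n i)] := by
    by_contra hli
    have hv := mem_openSegment_of_not_linearIndependent (vertex_ne_vertex_finRotate hP i)
      (vertex_ne_vertex_finRotate hP (finRotate n i)).symm
      (fun z hz => eq_vertex_of_mem_edge_of_mem_edge_finRotate hP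
        (segment_symm ℝ (P i) (P (finRotate n i)) ▸ hz.1) hz.2) hli
    refine (norm_lt_norm_of_mem_openSegment (fun he => ?_) hv (hmax i)).not_ge (hmax _)
    rw [← he, openSegment_same] at hv
    exact vertex_ne_vertex_finRotate hP i (mem_singleton_iff.1 hv).symm
  obtain ⟨A, B, hA₁, hA₂, hB₁, hB₂, hAB⟩ := exists_dual_coordinates hli
  exact ⟨A, B, hA₁, hB₁, hA₂, hB₂, hAB⟩

lemma IsCornerFrame.eventually_nonneg (hP : P.IsSimple) (h : IsCornerFrame P i A B) :
    ∀ᶠ y in 𝓝 (P (finRotate n i)), y ∈ P.boundary ℝ → 0 ≤ B (y - P (finRotate n i)) := by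
  filter_upwards [eventually_mem_boundary_iff P (P (finRotate n i))] with y hy hyP
  obtain ⟨j, hj, hyj⟩ := hy.1 hyP
  rcases eq_or_eq_finRotate_of_vertex_mem_edge hP hj with rfl | hji
  · exact (h.mem_edge_finRotate_iff.1 hyj).1.1
  · obtain rfl := (finRotate n).injective hji
    exact (h.mem_edge_iff.1 hyj).2.ge

lemma IsCornerFrame.exists_windingNumber_eq_zero_of_neg (hP : P.IsSimple)
    (h : IsCornerFrame P i A B) (hmax : ∀ j, ‖P j‖ ≤ ‖P (finRotate n i)‖) :
    ∃ ε > 0, ∀ y ∈ Metric.ball (P (finRotate n i)) ε ∩ {z | 0 < (-B) (z - P (finRotate n i))},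
      windingNumber P y = 0 := by
  set v := P (finRotate n i)
  set w := P (finRotate n (finRotate n i))
  have hwv : w ≠ v := (vertex_ne_vertex_finRotate hP _).symm
  obtain ⟨ε, hε, hball⟩ := Metric.eventually_nhds_iff_ball.1 (h.eventually_nonneg hP)
  have hpos : 0 < (-B) (v - w) := by
    rw [neg_apply, ← map_neg, neg_sub, h.snd_next]
    exact one_pos
  obtain ⟨t, hmem, ht⟩ := ((eventually_add_smul_mem_ball_inter_pos (Metric.mem_ball_self hε)
    (by simp) hpos).and self_mem_nhdsWithin).exists
  refine ⟨ε, hε, fun y hy => ?_⟩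
  rw [windingNumber_eq_of_isPreconnected (isPreconnected_ball_inter_pos (-B) v ε) ?_ hy hmem]
  · refine windingNumber_add_smul_eq_zero (sub_ne_zero.2 hwv.symm) (fun s hs hsP => ?_) ht
    exact (norm_le_of_mem_boundary hmax hsP).not_gt (norm_lt_norm_add_smul_sub hwv (hmax _) hs)
  · exact disjoint_left.2 fun x hx hxP => (neg_pos.1 hx.2).not_ge (hball x hx.1 hxP)

lemma IsCornerFrame.exists_mem_openCorner_windingNumber_ne_zero (hP : P.IsSimple)
    (h : IsCornerFrame P i A B) (hmax : ∀ j, ‖P j‖ ≤ ‖P (finRotate n i)‖) (hc : 0 < c) :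
    ∃ m ∈ openCorner P i A B c, windingNumber P m ≠ 0 := by
  obtain ⟨ε, hε, hzero⟩ := h.exists_windingNumber_eq_zero_of_neg hP hmax
  set v := P (finRotate n i)
  set e := P i - v
  set e' := P (finRotate n (finRotate n i)) - v
  obtain ⟨ρ, hρball, hρ, hρlt⟩ : ∃ ρ : ℝ, v + ρ • e ∈ Metric.ball v ε ∧ 0 < ρ ∧ ρ < min 1 c :=
    (((tendsto_add_smul_nhds_zero v e).mono_left nhdsWithin_le_nhds |>.eventually
      (Metric.ball_mem_nhds v hε)).and (Ioo_mem_nhdsGT (lt_min one_pos hc))).exists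
  have hz : v + ρ • e ∈ openSegment ℝ (P i) v := by
    rw [openSegment_symm]
    exact mem_openSegment_iff_exists_add_smul.2 ⟨ρ, ⟨hρ, hρlt.trans_le (min_le_left _ _)⟩, rfl⟩
  have hA : ∀ t : ℝ, A (v + ρ • e + t • e' - v) = ρ := fun t => by
    rw [add_assoc, add_sub_cancel_left, map_add, map_smul, map_smul, h.fst_prev, h.fst_next]
    simp
  have hB : ∀ t : ℝ, B (v + ρ • e + t • e' - v) = t := fun t => by
    rw [add_assoc, add_sub_cancel_left, map_add, map_smul, map_smul, h.snd_prev, h.snd_next]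
    simp
  have hneg : 0 < (-B) (-e') := by
    rw [neg_apply, map_neg, neg_neg, h.snd_next]
    exact one_pos
  have hneg' : 0 ≤ (-B) (v + ρ • e - v) := by
    rw [neg_apply, add_sub_cancel_left, map_smul, h.snd_prev, smul_zero, neg_zero]
  obtain ⟨t, ⟨-, -, hjump⟩, hside, ht, htc⟩ :=
    ((eventually_abs_windingNumber_sub_eq_one hz
      (fun j hj => notMem_edge_of_mem_openSegment_edge hP hj hz) h.linearIndependent).and
      ((eventually_add_smul_mem_ball_inter_pos hρball hneg' hneg).and (Ioo_mem_nhdsGT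
        (sub_pos.2 (hρlt.trans_le (min_le_right _ _)))))).exists
  refine ⟨v + ρ • e + t • e', ⟨?_, ?_, ?_⟩, fun h0 => ?_⟩
  · rwa [hA]
  · rwa [hB]
  · rw [hA, hB]
    linarith
  · rw [neg_smul, ← smul_neg, hzero _ hside, h0] at hjump
    norm_num at hjump

lemma IsCornerFrame.openCorner_subset_body (hP : P.IsSimple) (h : IsCornerFrame P i A B)
    (hmax : ∀ j, ‖P j‖ ≤ ‖P (finRotate n i)‖) (hc : 0 < c)
    (hdisj : Disjoint (openCorner P i A B c) (P.boundary ℝ)) : openCorner P i A B c ⊆ body P := by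
  obtain ⟨m, hm, hm0⟩ := h.exists_mem_openCorner_windingNumber_ne_zero hP hmax hc
  intro z hz
  rw [mem_body_iff_windingNumber_ne_zero hP (disjoint_left.1 hdisj hz),
    windingNumber_eq_of_isPreconnected convex_openCorner.isPreconnected hdisj hz hm]
  exact hm0

lemma openSegment_subset_openCorner {q : Plane}
    (hA : 0 < A (q - P (finRotate n i))) (hB : 0 < B (q - P (finRotate n i))) :
    openSegment ℝ (P (finRotate n i)) q ⊆
      openCorner P i A B (A (q - P (finRotate n i)) + B (q - P (finRotate n i))) := by
  intro z hz
  obtain ⟨t, ⟨ht, ht1⟩, rfl⟩ := mem_openSegment_iff_exists_add_smul.1 hz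
  simp only [openCorner, mem_ofPred_eq, add_sub_cancel_left, map_smul, smul_eq_mul]
  exact ⟨by positivity, by positivity, by nlinarith⟩

/-- A vertex of the corner triangle that is nearest to the corner is visible from it. -/
lemma IsCornerFrame.isDiagonal_of_forall_le (hP : P.IsSimple) (h : IsCornerFrame P i A B)
    (hmax : ∀ j, ‖P j‖ ≤ ‖P (finRotate n i)‖) (hki : k ≠ i) (hki' : k ≠ finRotate n i)
    (hki'' : k ≠ finRotate n (finRotate n i)) (hA : 0 ≤ A (P k - P (finRotate n i)))
    (hB : 0 ≤ B (P k - P (finRotate n i)))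
    (hAB : A (P k - P (finRotate n i)) + B (P k - P (finRotate n i)) ≤ 1)
    (hmin : ∀ l, l ≠ i → l ≠ finRotate n i → l ≠ finRotate n (finRotate n i) →
      0 ≤ A (P l - P (finRotate n i)) → 0 ≤ B (P l - P (finRotate n i)) →
      A (P k - P (finRotate n i)) + B (P k - P (finRotate n i)) ≤
        A (P l - P (finRotate n i)) + B (P l - P (finRotate n i))) :
    IsDiagonal P (finRotate n i) k := by
  obtain ⟨hA', hB'⟩ := h.pos_of_nonneg hP hki hki' hki'' hA hB hAB
  have hdisj := h.disjoint_openCorner_boundary hP hAB fun l hl hlA hlB => by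
    rcases eq_or_ne l i with rfl | hli
    · rwa [h.fst_prev, h.snd_prev, add_zero]
    rcases eq_or_ne l (finRotate n (finRotate n i)) with rfl | hli''
    · rwa [h.fst_next, h.snd_next, zero_add]
    exact hmin l hli hl hli'' hlA hlB
  have hsub := openSegment_subset_openCorner (P := P) (i := i) hA' hB'
  exact ⟨hki'.symm, hki'', fun he => hki ((finRotate n).injective he).symm,
    hdisj.mono_left hsub, subset_compl_iff_disjoint_right.1
      (hsub.trans (h.openCorner_subset_body hP hmax (by positivity) hdisj))⟩

lemma finRotate_finRotate_ne_self (hn : 3 ≤ n) (i : Fin n) : finRotate n (finRotate n i) ≠ i := by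
  rw [Ne, Fin.ext_iff, val_finRotate, val_finRotate]
  have := i.2
  split_ifs <;> lia

lemma finRotate_finRotate_finRotate_ne_self (hn : 4 ≤ n) (i : Fin n) :
    finRotate n (finRotate n (finRotate n i)) ≠ i := by
  rw [Ne, Fin.ext_iff, val_finRotate, val_finRotate, val_finRotate]
  have := i.2
  split_ifs <;> lia

lemma IsCornerFrame.lt_of_mem_edge (hP : P.IsSimple) (h : IsCornerFrame P i A B)
    (hnone : ∀ l, l ≠ i → l ≠ finRotate n i →
      l ≠ finRotate n (finRotate n i) → 0 ≤ A (P l - P (finRotate n i)) →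
      0 ≤ B (P l - P (finRotate n i)) →
      1 < A (P l - P (finRotate n i)) + B (P l - P (finRotate n i)))
    (hA : 0 < A (z - P (finRotate n i))) (hB : 0 < B (z - P (finRotate n i)))
    (hAB : A (z - P (finRotate n i)) + B (z - P (finRotate n i)) = 1)
    (hz : z ∈ segment ℝ (P j) (P (finRotate n j))) (hk : k = j ∨ k = finRotate n j) (hki : k ≠ i)
    (hki' : k ≠ finRotate n (finRotate n i)) : (A + B) z < (A + B) (P k) := by
  obtain ⟨hji, hji'⟩ := h.ne_of_mem_edge hz hA hB
  have hkv : k ≠ finRotate n i := by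
    rcases hk with rfl | rfl
    · exact hji'
    · exact (finRotate n).injective.ne hji
  by_contra! hle
  have hkAB : A (P k - P (finRotate n i)) + B (P k - P (finRotate n i)) ≤ 1 := by
    simp only [map_sub, add_apply] at hAB hle ⊢
    linarith
  obtain ⟨hkA, hkB⟩ := h.nonneg_of_mem_edge hP hz hA hB hAB.le hk hkAB
  exact (hnone k hki hkv hki' hkA hkB).not_ge hkAB

lemma IsCornerFrame.notMem_boundary_of_add_eq_one (hP : P.IsSimple) (hn : 4 ≤ n)
    (h : IsCornerFrame P i A B) (hnone : ∀ l, l ≠ i → l ≠ finRotate n i →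
      l ≠ finRotate n (finRotate n i) → 0 ≤ A (P l - P (finRotate n i)) →
      0 ≤ B (P l - P (finRotate n i)) →
      1 < A (P l - P (finRotate n i)) + B (P l - P (finRotate n i)))
    (hA : 0 < A (z - P (finRotate n i))) (hB : 0 < B (z - P (finRotate n i)))
    (hAB : A (z - P (finRotate n i)) + B (z - P (finRotate n i)) = 1) :
    z ∉ P.boundary ℝ := by
  intro hz
  obtain ⟨j, hj⟩ := mem_boundary_iff.1 hz
  obtain ⟨hji, hji'⟩ := h.ne_of_mem_edge hj hA hB
  have hfar {k : Fin n} := h.lt_of_mem_edge hP hnone hA hB hAB hj (k := k)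
  by_cases hj'' : j = finRotate n (finRotate n i)
  · subst hj''
    have hfar' := hfar (Or.inr rfl) (finRotate_finRotate_finRotate_ne_self hn i)
      (finRotate_ne_self (by lia) _)
    have hzw : (A + B) z = (A + B) (P (finRotate n (finRotate n i))) := by
      have := h.fst_next
      have := h.snd_next
      simp only [map_sub, add_apply] at *
      linarith
    rw [eq_left_of_mem_segment (A + B) hj hzw.le (hzw ▸ hfar'), h.fst_next] at hA
    exact hA.false
  by_cases hj' : finRotate n j = i
  · have hfar' := hfar (Or.inl rfl) hji hj''
    have hzw : (A + B) z = (A + B) (P i) := by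
      have := h.fst_prev
      have := h.snd_prev
      simp only [map_sub, add_apply] at *
      linarith
    rw [hj', segment_symm] at hj
    rw [eq_left_of_mem_segment (A + B) hj hzw.le (hzw ▸ hfar'), h.snd_prev] at hB
    exact hB.false
  exact (le_or_le_of_mem_segment (A + B) hj).elim (hfar (Or.inl rfl) hji hj'').not_ge
    (hfar (Or.inr rfl) hj' ((finRotate n).injective.ne hji')).not_ge

lemma IsCornerFrame.pos_of_mem_openSegment (h : IsCornerFrame P i A B)
    (hz : z ∈ openSegment ℝ (P i) (P (finRotate n (finRotate n i)))) :
    0 < A (z - P (finRotate n i)) ∧ 0 < B (z - P (finRotate n i)) ∧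
      A (z - P (finRotate n i)) + B (z - P (finRotate n i)) = 1 := by
  obtain ⟨t, ⟨ht, ht1⟩, rfl⟩ := mem_openSegment_iff_exists_add_smul.1 hz
  have hsplit : P i + t • (P (finRotate n (finRotate n i)) - P i) - P (finRotate n i) =
      (1 - t) • (P i - P (finRotate n i)) +
        t • (P (finRotate n (finRotate n i)) - P (finRotate n i)) := by
    module
  simp only [hsplit, map_add, map_smul, h.fst_prev, h.fst_next, h.snd_prev, h.snd_next,
    smul_eq_mul]
  exact ⟨by linarith, by linarith, by ring⟩

lemma mem_closure_openCorner (hA : 0 < A (z - P (finRotate n i)))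
    (hB : 0 < B (z - P (finRotate n i)))
    (hAB : A (z - P (finRotate n i)) + B (z - P (finRotate n i)) = c) :
    z ∈ closure (openCorner P i A B c) := by
  refine mem_closure_of_eventually_add_smul_mem (d := P (finRotate n i) - z) ?_
  filter_upwards [Ioo_mem_nhdsGT one_pos] with t ⟨ht, ht1⟩
  have hsub : z + t • (P (finRotate n i) - z) - P (finRotate n i) =
      (1 - t) • (z - P (finRotate n i)) := by
    module
  simp only [openCorner, mem_ofPred_eq, hsub, map_smul, smul_eq_mul]
  exact ⟨mul_pos (by linarith) hA, mul_pos (by linarith) hB, by nlinarith⟩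

lemma IsCornerFrame.isDiagonal_of_forall_lt (hP : P.IsSimple) (hn : 4 ≤ n)
    (h : IsCornerFrame P i A B) (hmax : ∀ j, ‖P j‖ ≤ ‖P (finRotate n i)‖)
    (hnone : ∀ l, l ≠ i → l ≠ finRotate n i → l ≠ finRotate n (finRotate n i) →
      0 ≤ A (P l - P (finRotate n i)) → 0 ≤ B (P l - P (finRotate n i)) →
      1 < A (P l - P (finRotate n i)) + B (P l - P (finRotate n i))) :
    IsDiagonal P i (finRotate n (finRotate n i)) := by
  have hdisj := h.disjoint_openCorner_boundary hP le_rfl fun l hl hlA hlB => by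
    rcases eq_or_ne l i with rfl | hli
    · rw [h.fst_prev, h.snd_prev, add_zero]
    rcases eq_or_ne l (finRotate n (finRotate n i)) with rfl | hli''
    · rw [h.fst_next, h.snd_next, zero_add]
    exact (hnone l hli hl hli'' hlA hlB).le
  refine ⟨(finRotate_finRotate_ne_self (by lia) i).symm, finRotate_ne_self (by lia) _,
    (finRotate_finRotate_finRotate_ne_self hn i).symm, disjoint_left.2 fun z hz => ?_,
    subset_compl_iff_disjoint_right.1 fun z hz => ?_⟩ <;>
    obtain ⟨hA, hB, hAB⟩ := h.pos_of_mem_openSegment hz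
  · exact h.notMem_boundary_of_add_eq_one hP hn hnone hA hB hAB
  · exact closure_minimal (h.openCorner_subset_body hP hmax one_pos hdisj) (isClosed_body hP)
      (mem_closure_openCorner hA hB hAB)

end CornerFrame

lemma exists_isDiagonal {n : ℕ} {P : Polygon Plane n} (hP : P.IsSimple) (hn : 4 ≤ n) :
    ∃ a b, IsDiagonal P a b := by
  have : Nonempty (Fin n) := ⟨0, by lia⟩
  obtain ⟨i', hi'⟩ := Finite.exists_max fun j => ‖P j‖
  obtain ⟨i, rfl⟩ := (finRotate n).surjective i'
  obtain ⟨A, B, h⟩ := exists_isCornerFrame_of_norm_le hP hi'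
  set v := P (finRotate n i)
  by_cases hnone : ∀ l, l ≠ i → l ≠ finRotate n i → l ≠ finRotate n (finRotate n i) →
      0 ≤ A (P l - v) → 0 ≤ B (P l - v) → 1 < A (P l - v) + B (P l - v)
  · exact ⟨_, _, h.isDiagonal_of_forall_lt hP hn hi' hnone⟩
  push Not at hnone
  obtain ⟨l, hl, hl', hl'', hlA, hlB, hlAB⟩ := hnone
  obtain ⟨k, ⟨hk, hk', hk'', hkA, hkB⟩, hmin⟩ := exists_min_image
    {k | k ≠ i ∧ k ≠ finRotate n i ∧ k ≠ finRotate n (finRotate n i) ∧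
      0 ≤ A (P k - v) ∧ 0 ≤ B (P k - v)}
    (fun k => A (P k - v) + B (P k - v)) (toFinite _) ⟨l, hl, hl', hl'', hlA, hlB⟩
  exact ⟨_, k, h.isDiagonal_of_forall_le hP hi' hk hk' hk'' hkA hkB
    ((hmin l ⟨hl, hl', hl'', hlA, hlB⟩).trans hlAB)
    fun m hm hm' hm'' hmA hmB => hmin m ⟨hm, hm', hm'', hmA, hmB⟩⟩

/-! ### Uncrossed chords -/

section Uncrossed

variable {n k l : ℕ}

lemma exists_isArc (a b : Fin n) : ∃ k, ∃ f : Fin k → Fin n, IsArc a b f := by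
  classical
  set S := Finset.univ.filter fun w : Fin n => btw a w b with hS
  refine ⟨S.card, S.orderEmbOfFin rfl, (S.orderEmbOfFin rfl).strictMono, fun w => ?_⟩
  rw [← mem_range, Finset.range_orderEmbOfFin, hS]
  simp

variable {P : Polygon Plane n} {a b x y u v : Fin n} {f : Fin k → Fin n}

lemma IsDiagonal.isChord (hd : IsDiagonal P a b) : P.IsChord a b :=
  ⟨⟨hd.ne, mutuallyVisible_iff.2 hd.segment_subset_body⟩, hd.ne_finRotate, hd.ne_finRotate'⟩

lemma isChord_symm (h : P.IsChord x y) : P.IsChord y x := ⟨h.1.symm, h.2.2, h.2.1⟩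

lemma adj_finRotate (hP : P.IsSimple) (i : Fin n) : P.visibilityGraph.Adj i (finRotate n i) :=
  ⟨(finRotate_ne_self (by have := hP.three_le; lia) i).symm, mutuallyVisible_iff.2 fun _ hz =>
    boundary_subset_body P (mem_boundary_iff.2 ⟨i, hz⟩)⟩

lemma vertex_mem_body_reindex (P : Polygon Plane n) (f : Fin k → Fin n) (i : Fin k) :
    P (f i) ∈ body (reindex P f) :=
  boundary_subset_body _ (vertex_mem_boundary (reindex P f) i)

lemma not_btw_finRotate (hab : a ≠ b) (ha : a ≠ finRotate n b) : ¬ btw a (finRotate n b) b :=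
  (sbtw_finRotate hab.symm ha).not_btw

lemma IsDiagonal.apply_ne_finRotate (hd : IsDiagonal P a b) (hf : IsArc a b f) {i j : Fin k}
    (h : j ≠ finRotate k i) : f j ≠ finRotate n (f i) := by
  intro h'
  by_cases hib : f i = b
  · refine not_btw_finRotate hd.ne hd.ne_finRotate' ?_
    rw [← hib, ← h', hib]
    exact hf.btw_apply j
  · exact h (hf.injective (h'.trans (hf.apply_finRotate_of_ne hd.ne hib).symm))

lemma IsDiagonal.of_reindex (hP : P.IsSimple) (hd : IsDiagonal P a b) (hf : IsArc a b f)
    {i j : Fin k} (h : IsDiagonal (reindex P f) i j) : IsDiagonal P (f i) (f j) := by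
  have hbody : openSegment ℝ (P (f i)) (P (f j)) ⊆ body (reindex P f) := fun z hz =>
    disjoint_left.1 h.disjoint_exterior hz
  refine ⟨hf.injective.ne h.ne, hd.apply_ne_finRotate hf h.ne_finRotate,
    hd.apply_ne_finRotate hf h.ne_finRotate', disjoint_left.2 fun z hz hzC => ?_,
    disjoint_left.2 fun z hz => hd.body_reindex_subset hP hf (hbody hz)⟩
  exact disjoint_left.1 h.disjoint_boundary hz
    (hd.mem_boundary_reindex_of_mem_body hP hf hzC (hbody hz))

lemma IsDiagonal.card_lt_of_isArc (hd : IsDiagonal P a b) (hf : IsArc a b f) : k < n := by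
  have hsurj : ¬ Function.Surjective f := fun hs => by
    obtain ⟨i, hi⟩ := hs (finRotate n b)
    exact not_btw_finRotate hd.ne hd.ne_finRotate' (hi ▸ hf.btw_apply i)
  simpa using Fintype.card_lt_of_injective_not_surjective f hf.injective hsurj

lemma IsArc.ne_finRotate (hf : IsArc a b f) (hab : a ≠ b) {i j : Fin k}
    (h : ¬ (f i = b ∧ f j = a)) (h' : f j ≠ finRotate n (f i)) : j ≠ finRotate k i := by
  rintro rfl
  by_cases hib : f i = b
  · exact h ⟨hib, hf.apply_finRotate_of_eq hab hib⟩
  · exact h' (hf.apply_finRotate_of_ne hab hib)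

lemma sbtw_and_sbtw_comm : sbtw a x b ∧ sbtw b y a ↔ sbtw x b y ∧ sbtw y a x := by
  simp only [sbtw_iff_val]
  lia

lemma btw_and_btw_or_of_not_separated (h : ¬ (sbtw a x b ∧ sbtw b y a))
    (h' : ¬ (sbtw a y b ∧ sbtw b x a)) : (btw a x b ∧ btw a y b) ∨ (btw b x a ∧ btw b y a) := by
  simp only [sbtw_iff_not_btw, not_and_or, not_not] at h h'
  have hx := btw_total a x b
  have hy := btw_total a y b
  tauto

lemma four_le_of_ne_finRotate (hn : 3 ≤ n) (hxy : x ≠ y) (h : y ≠ finRotate n x)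
    (h' : x ≠ finRotate n y) : 4 ≤ n := by
  have := x.2
  have := y.2
  rw [Ne, Fin.ext_iff] at hxy h h'
  rw [val_finRotate] at h h'
  split_ifs at h h' <;> lia

theorem isDiagonal_or_exists_separating (hP : P.IsSimple) (hxy : x ≠ y)
    (h : y ≠ finRotate n x) (h' : x ≠ finRotate n y) :
    IsDiagonal P x y ∨ ∃ u v, IsDiagonal P u v ∧ sbtw x u y ∧ sbtw y v x := by
  induction n using Nat.strong_induction_on with
  | _ n ih =>
  have same_side : ∀ a b, IsDiagonal P a b → btw a x b → btw a y b → ¬ (x = b ∧ y = a) →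
      ¬ (y = b ∧ x = a) →
      IsDiagonal P x y ∨ ∃ u v, IsDiagonal P u v ∧ sbtw x u y ∧ sbtw y v x := by
    intro a b hd hx hy hba hab
    obtain ⟨k, f, hf⟩ := exists_isArc a b
    obtain ⟨i, rfl⟩ := (hf.exists_apply_eq_iff x).2 hx
    obtain ⟨j, rfl⟩ := (hf.exists_apply_eq_iff y).2 hy
    rcases ih k (hd.card_lt_of_isArc hf) (hd.isSimple_reindex hP hf) (ne_of_apply_ne f hxy)
      (hf.ne_finRotate hd.ne hba h) (hf.ne_finRotate hd.ne hab h') with hij | ⟨u, v, huv, hu, hv⟩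
    · exact Or.inl (hd.of_reindex hP hf hij)
    · exact Or.inr ⟨f u, f v, hd.of_reindex hP hf huv, (sbtw_map_iff hf.strictMono).2 hu,
        (sbtw_map_iff hf.strictMono).2 hv⟩
  obtain ⟨a, b, hd⟩ := exists_isDiagonal hP (four_le_of_ne_finRotate hP.three_le hxy h h')
  by_cases hab : x = a ∧ y = b
  · rw [hab.1, hab.2]
    exact Or.inl hd
  by_cases hba : x = b ∧ y = a
  · rw [hba.1, hba.2]
    exact Or.inl hd.symm
  by_cases hsep : sbtw a x b ∧ sbtw b y a
  · exact Or.inr ⟨b, a, hd.symm, sbtw_and_sbtw_comm.1 hsep⟩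
  by_cases hsep' : sbtw a y b ∧ sbtw b x a
  · exact Or.inr ⟨a, b, hd, (sbtw_and_sbtw_comm.1 hsep').symm⟩
  rcases btw_and_btw_or_of_not_separated hsep hsep' with ⟨hx, hy⟩ | ⟨hx, hy⟩
  · exact same_side a b hd hx hy hba fun h => hab h.symm
  · exact same_side b a hd.symm hx hy hab fun h => hba h.symm

lemma IsDiagonal.segment_inter_nonempty_of_adj (hP : P.IsSimple) (hd : IsDiagonal P a b)
    (hu : sbtw a u b) (hv : sbtw b v a) (huv : P.visibilityGraph.Adj u v) :
    (segment ℝ (P u) (P v) ∩ segment ℝ (P a) (P b)).Nonempty := by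
  obtain ⟨k, f, hf⟩ := exists_isArc a b
  obtain ⟨l, g, hg⟩ := exists_isArc b a
  obtain ⟨i, rfl⟩ := (hf.exists_apply_eq_iff u).2 hu.btw
  obtain ⟨j, rfl⟩ := (hg.exists_apply_eq_iff v).2 hv.btw
  exact hd.segment_inter_nonempty hP hf hg (vertex_mem_body_reindex P f i)
    (vertex_mem_body_reindex P g j) (mutuallyVisible_iff.1 huv.2)

lemma isChord_of_separated (hu : sbtw x u y) (hv : sbtw y v x)
    (huv : P.visibilityGraph.Adj u v) : P.IsChord u v := by
  rw [sbtw_iff_val] at hu hv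
  refine ⟨huv, ?_, ?_⟩ <;>
  · rw [Ne, Fin.ext_iff, val_finRotate]
    split_ifs <;> lia

lemma isDiagonal_of_isUncrossedChord (hP : P.IsSimple) (h : P.IsUncrossedChord x y) :
    IsDiagonal P x y := by
  refine (isDiagonal_or_exists_separating hP h.1.1.1 h.1.2.1 h.1.2.2).resolve_right ?_
  rintro ⟨u, v, hd, hu, hv⟩
  refine h.2 u v hd.isChord ⟨?_, Or.inl ⟨hu, hv⟩⟩
  rw [inter_comm, segment_symm ℝ (P x)]
  obtain ⟨hy, hx⟩ := sbtw_and_sbtw_comm.1 ⟨hu, hv⟩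
  exact hd.segment_inter_nonempty_of_adj hP hy hx h.1.1.symm

lemma isUncrossedChord_symm (h : P.IsUncrossedChord x y) : P.IsUncrossedChord y x := by
  refine ⟨isChord_symm h.1, fun u v huv hc => h.2 u v huv ⟨?_, ?_⟩⟩
  · rw [segment_symm ℝ (P x)]
    exact hc.1
  · exact hc.2.symm.imp And.symm And.symm

lemma not_adj_of_isUncrossedChord (hP : P.IsSimple) (h : P.IsUncrossedChord x y)
    (hu : sbtw x u y) (hv : sbtw y v x) : ¬ P.visibilityGraph.Adj u v := fun huv =>
  h.2 u v (isChord_of_separated hu hv huv)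
    ⟨(isDiagonal_of_isUncrossedChord hP h).segment_inter_nonempty_of_adj hP hu hv huv,
      Or.inl ⟨hu, hv⟩⟩

end Uncrossed

section Cycle

variable {k : ℕ} {V : Type*} {G : SimpleGraph V} {f : Fin k → V} {a b i j : Fin k}

lemma sbtw_induction {p : Fin k → Prop} (hleft : p (finRotate k a))
    (hrotate : ∀ i, sbtw a i b → p i → p (finRotate k i)) (hi : sbtw a i b) : p i := by
  induction hd : (if a.val < i.val then i.val - a.val else i.val + k - a.val)
    using Nat.strong_induction_on generalizing i with
  | _ d ih =>
    obtain ⟨j, rfl⟩ := (finRotate k).surjective i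
    by_cases hja : j = a
    · rwa [hja]
    rw [Fin.ext_iff] at hja
    have hval := val_finRotate j
    rw [sbtw_iff_val] at hi
    have hj : sbtw a j b := by
      rw [sbtw_iff_val]
      split_ifs at hval <;> lia
    refine hrotate j hj (ih _ ?_ hj rfl)
    split_ifs at hval hd ⊢ <;> lia

lemma sbtw_or_sbtw (hab : a ≠ b) (ha : i ≠ a) (hb : i ≠ b) : sbtw a i b ∨ sbtw b i a := by
  rw [sbtw_iff_not_btw, sbtw_iff_not_btw, ← not_and_or]
  exact fun h => (eq_or_eq_of_btw_of_btw hab h.2 h.1).elim ha hb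

lemma reachable_of_sbtw (hadj : ∀ i, G.Adj (f i) (f (finRotate k i))) {U : Set V}
    (hU : ∀ i, sbtw a i b → f i ∈ U) (hi : sbtw a i b) (hj : sbtw a j b) :
    (G.induce U).Reachable ⟨f i, hU i hi⟩ ⟨f j, hU j hj⟩ := by
  have hfirst : sbtw a (finRotate k a) b := by
    refine sbtw_finRotate ?_ ?_ <;> rintro rfl
    · exact sbtw_irrefl_left_right hi
    · exact not_sbtw_finRotate _ _ hi
  have hreach {m : Fin k} (hm : sbtw a m b) :
      (G.induce U).Reachable ⟨f (finRotate k a), hU _ hfirst⟩ ⟨f m, hU m hm⟩ :=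
    sbtw_induction (p := fun m => ∀ hm : sbtw a m b,
        (G.induce U).Reachable ⟨f (finRotate k a), hU _ hfirst⟩ ⟨f m, hU m hm⟩)
      (fun _ => .rfl) (fun m hm ih _ => (ih hm).trans (SimpleGraph.Adj.reachable (hadj m))) hm hm
  exact (hreach hi).symm.trans (hreach hj)

lemma mem_range_diff_of_sbtw (hf : Function.Injective f) (h : sbtw a i b) :
    f i ∈ range f \ {f a, f b} := by
  refine ⟨⟨i, rfl⟩, ?_⟩
  rintro (hi | hi) <;> obtain rfl := hf hi
  · exact sbtw_irrefl_left h
  · exact sbtw_irrefl_right h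

lemma exists_sbtw_of_mem_range_diff (hab : a ≠ b) {v : V} (hv : v ∈ range f \ {f a, f b}) :
    ∃ i, f i = v ∧ (sbtw a i b ∨ sbtw b i a) := by
  obtain ⟨⟨i, rfl⟩, hi⟩ := hv
  exact ⟨i, rfl, sbtw_or_sbtw hab (fun h => hi (by simp [h])) fun h => hi (by simp [h])⟩

lemma preconnected_induce_of_adj (hf : Function.Injective f)
    (hadj : ∀ i, G.Adj (f i) (f (finRotate k i))) (hab : a ≠ b) {u v : Fin k}
    (hu : sbtw a u b) (hv : sbtw b v a) (huv : G.Adj (f u) (f v)) :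
    (G.induce (range f \ {f a, f b})).Preconnected := by
  have hU (i : Fin k) (hi : sbtw a i b) : f i ∈ range f \ {f a, f b} :=
    mem_range_diff_of_sbtw hf hi
  have hU' (i : Fin k) (hi : sbtw b i a) : f i ∈ range f \ {f a, f b} := by
    rw [pair_comm]
    exact mem_range_diff_of_sbtw hf hi
  have hlink : (G.induce (range f \ {f a, f b})).Adj ⟨f v, hU' v hv⟩ ⟨f u, hU u hu⟩ := huv.symm
  have hreach (w : ↥(range f \ {f a, f b})) :
      (G.induce (range f \ {f a, f b})).Reachable w ⟨f u, hU u hu⟩ := by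
    obtain ⟨w, hw⟩ := w
    obtain ⟨i, rfl, hi | hi⟩ := exists_sbtw_of_mem_range_diff hab hw
    · exact reachable_of_sbtw hadj hU hi hu
    · exact (reachable_of_sbtw hadj hU' hi hv).trans hlink.reachable
  exact fun w w' => (hreach w).trans (hreach w').symm

lemma preconnected_induce_of_eq_finRotate (hf : Function.Injective f)
    (hadj : ∀ i, G.Adj (f i) (f (finRotate k i))) (hab : a ≠ b) (hb : b = finRotate k a) :
    (G.induce (range f \ {f a, f b})).Preconnected := by
  have hside {v : V} (hv : v ∈ range f \ {f b, f a}) : ∃ i, f i = v ∧ sbtw b i a := by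
    obtain ⟨i, hi, h⟩ := exists_sbtw_of_mem_range_diff hab.symm hv
    exact ⟨i, hi, h.resolve_right fun h => not_sbtw_finRotate a i (hb ▸ h)⟩
  rw [pair_comm]
  rintro ⟨v, hv⟩ ⟨w, hw⟩
  obtain ⟨i, rfl, hi⟩ := hside hv
  obtain ⟨j, rfl, hj⟩ := hside hw
  exact reachable_of_sbtw hadj (fun _ => mem_range_diff_of_sbtw hf) hi hj

lemma exists_sbtw_of_reachable (hab : a ≠ b)
    (hno : ∀ u v, sbtw a u b → sbtw b v a → ¬ G.Adj (f u) (f v))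
    {x y : ↥(range f \ {f a, f b})} (h : (G.induce (range f \ {f a, f b})).Reachable x y)
    (hx : ∃ i, f i = x ∧ sbtw a i b) : ∃ i, f i = y ∧ sbtw a i b := by
  obtain ⟨w⟩ := h
  induction w with
  | nil => exact hx
  | @cons u v w huv _ ih =>
    obtain ⟨i, hiu, hi⟩ := hx
    obtain ⟨j, hjv, hj⟩ := exists_sbtw_of_mem_range_diff hab v.2
    have hij : G.Adj (f i) (f j) := by
      rw [hiu, hjv]
      exact huv
    exact ih ⟨j, hjv, hj.resolve_right fun hj => hno i j hi hj hij⟩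

theorem preconnected_induce_range_diff_iff (hf : Function.Injective f)
    (hadj : ∀ i, G.Adj (f i) (f (finRotate k i))) (hab : a ≠ b) :
    (G.induce (range f \ {f a, f b})).Preconnected ↔ b = finRotate k a ∨ a = finRotate k b ∨
      ∃ u v, sbtw a u b ∧ sbtw b v a ∧ G.Adj (f u) (f v) := by
  constructor
  · intro hpre
    by_contra! hcon
    obtain ⟨ha, hb, hno⟩ := hcon
    have hfirst := sbtw_finRotate hab ha
    have hfirst' := sbtw_finRotate hab.symm hb
    obtain ⟨i, hi, hi'⟩ := exists_sbtw_of_reachable hab hno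
      (hpre ⟨_, mem_range_diff_of_sbtw hf hfirst⟩
        ⟨_, pair_comm (f b) (f a) ▸ mem_range_diff_of_sbtw hf hfirst'⟩) ⟨_, rfl, hfirst⟩
    obtain rfl := hf hi
    exact hi'.not_sbtw hfirst'
  · rintro (h | h | ⟨u, v, hu, hv, huv⟩)
    · exact preconnected_induce_of_eq_finRotate hf hadj hab h
    · rw [pair_comm]
      exact preconnected_induce_of_eq_finRotate hf hadj hab.symm h
    · exact preconnected_induce_of_adj hf hadj hab hu hv huv

end Cycle

section Bottleneck

variable {n : ℕ} {P : Polygon Plane n}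

lemma isUncrossedChord_iff_not_linked (hP : P.IsSimple) {x y : Fin n}
    (hadj : P.visibilityGraph.Adj x y) :
    P.IsUncrossedChord x y ↔ ¬ (y = finRotate n x ∨ x = finRotate n y ∨
      ∃ u v, sbtw x u y ∧ sbtw y v x ∧ P.visibilityGraph.Adj u v) := by
  constructor
  · rintro h (hxy | hyx | ⟨u, v, hu, hv, huv⟩)
    · exact h.1.2.1 hxy
    · exact h.1.2.2 hyx
    · exact not_adj_of_isUncrossedChord hP h hu hv huv
  · intro h
    simp only [not_or] at h
    refine ⟨⟨hadj, h.1, h.2.1⟩, fun u v huv hc => h.2.2 ?_⟩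
    rcases hc.2 with ⟨hu, hv⟩ | ⟨hv, hu⟩
    · exact ⟨u, v, hu, hv, huv.1⟩
    · exact ⟨v, u, hv, hu, huv.1.symm⟩

theorem isBottleneckPair_iff_isUncrossedChord (hP : P.IsSimple) (x y : Fin n) :
    P.visibilityGraph.IsBottleneckPair x y ↔ P.IsUncrossedChord x y := by
  refine (and_congr_right fun hadj => ?_).trans
    (and_iff_right_of_imp fun h : P.IsUncrossedChord x y => h.1.1)
  rw [isUncrossedChord_iff_not_linked hP hadj, compl_eq_univ_sdiff, ← range_id]
  exact not_congr (preconnected_induce_range_diff_iff Function.injective_id (adj_finRotate hP)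
    hadj.1)

end Bottleneck

/-! ### Chords with disjoint interiors -/

section Overlap

variable {E : Type*} [AddCommGroup E] [Module ℝ E] {p q x y z : E}

lemma eventually_add_smul_mem_openSegment (hz : z ∈ openSegment ℝ p q) :
    ∀ᶠ t in 𝓝 (0 : ℝ), z + t • (q - p) ∈ openSegment ℝ p q := by
  obtain ⟨s, hs, rfl⟩ := mem_openSegment_iff_exists_add_smul.1 hz
  have hlim : Tendsto (fun t : ℝ => s + t) (𝓝 0) (𝓝 s) := by
    simpa using (continuous_const_add s).tendsto 0
  filter_upwards [hlim (isOpen_Ioo.mem_nhds hs)] with t ht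
  exact mem_openSegment_iff_exists_add_smul.2 ⟨s + t, ht, by module⟩

lemma eq_of_sameRay_sub (hz : z ∈ openSegment ℝ p q) (hz' : z ∈ openSegment ℝ x y)
    (hray : SameRay ℝ (q - p) (y - x)) (hp : p ∉ openSegment ℝ x y)
    (hx : x ∉ openSegment ℝ p q) : p = x := by
  by_contra hpx
  have hpz : p ≠ z := fun h => hp (h ▸ hz')
  have hxz : x ≠ z := fun h => hx (h ▸ hz)
  have hray' : SameRay ℝ (p - z) (x - z) := by
    obtain ⟨t, ht, rfl⟩ := mem_openSegment_iff_exists_add_smul.1 hz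
    obtain ⟨s, hs, hst⟩ := mem_openSegment_iff_exists_add_smul.1 hz'
    rw [hst, ← hst, sub_add_cancel_left, hst, sub_add_cancel_left]
    exact ((hray.nonneg_smul_left ht.1.le).nonneg_smul_right hs.1.le).neg
  rw [openSegment_symm] at hz hz' hp hx
  rcases wbtw_total_of_sameRay_vsub_left (x := z) (y := p) (z := x) hray' with h | h
  · exact hp (mem_openSegment_of_mem_segment_of_mem_segment (openSegment_subset_segment _ _ _ hz')
      (mem_segment_iff_wbtw.2 h) hpz hpx)
  · exact hx (mem_openSegment_of_mem_segment_of_mem_segment (openSegment_subset_segment _ _ _ hz)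
      (mem_segment_iff_wbtw.2 h) hxz (Ne.symm hpx))

lemma endpoints_eq_of_not_linearIndependent (hz : z ∈ openSegment ℝ p q)
    (hz' : z ∈ openSegment ℝ x y) (hli : ¬ LinearIndependent ℝ ![q - p, y - x])
    (hp : p ∉ openSegment ℝ x y) (hq : q ∉ openSegment ℝ x y) (hx : x ∉ openSegment ℝ p q)
    (hy : y ∉ openSegment ℝ p q) : s(p, q) = s(x, y) := by
  rw [Sym2.eq_iff]
  rcases sameRay_or_sameRay_neg_iff_not_linearIndependent.2 hli with h | h
  · have h' := h.neg
    rw [neg_sub, neg_sub] at h'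
    refine Or.inl ⟨eq_of_sameRay_sub hz hz' h hp hx, ?_⟩
    rw [openSegment_symm] at hz hz' hq hy
    exact eq_of_sameRay_sub hz hz' h' hq hy
  · have h' := h.neg
    rw [neg_sub] at h
    rw [neg_sub, neg_neg] at h'
    refine Or.inr ⟨?_, ?_⟩
    · rw [openSegment_symm] at hz' hp
      exact eq_of_sameRay_sub hz hz' h hp hy
    · rw [openSegment_symm] at hz hx
      exact eq_of_sameRay_sub hz hz' h' hq hx

end Overlap

section Disjoint

variable {n : ℕ} {P : Polygon Plane n} {x y u v : Fin n} {p q z : Plane}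

lemma not_linearIndependent_edge_of_segment_subset_body (hP : P.IsSimple) {i : Fin n}
    (hpq : segment ℝ p q ⊆ body P) (hz : z ∈ openSegment ℝ p q)
    (hzi : z ∈ openSegment ℝ (P i) (P (finRotate n i))) :
    ¬ LinearIndependent ℝ ![P (finRotate n i) - P i, q - p] := by
  intro hli
  have hjump := eventually_abs_windingNumber_sub_eq_one hzi
    (fun j hj => notMem_edge_of_mem_openSegment_edge hP hj hzi) hli
  have hmem := eventually_add_smul_mem_openSegment hz
  have hneg := (continuous_neg.tendsto' (0 : ℝ) 0 neg_zero).eventually hmem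
  obtain ⟨t, ⟨ht, ht', hsub⟩, hzt, hzt'⟩ :=
    (hjump.and ((hmem.and hneg).filter_mono nhdsWithin_le_nhds)).exists
  have hbody {y : Plane} (hy : y ∈ openSegment ℝ p q) : y ∈ body P :=
    hpq (openSegment_subset_segment _ _ _ hy)
  have hne := (mem_body_iff_windingNumber_ne_zero hP ht).1 (hbody hzt)
  have hne' := (mem_body_iff_windingNumber_ne_zero hP ht').1 (hbody hzt')
  have hle := abs_le.1 (abs_windingNumber_le_one hP ht)
  have hle' := abs_le.1 (abs_windingNumber_le_one hP ht')
  rw [abs_eq one_pos.le] at hsub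
  obtain ⟨r, hr⟩ := exists_int_eq_windingNumber ht
  obtain ⟨s, hs⟩ := exists_int_eq_windingNumber ht'
  rw [hr] at hne hle
  rw [hs] at hne' hle'
  rw [hr, hs] at hsub
  norm_cast at hne hne' hle hle' hsub
  lia

lemma not_linearIndependent_of_isDiagonal (hP : P.IsSimple) (hd : IsDiagonal P x y)
    (hu : btw x u y) (hv : btw x v y) (huv : P.visibilityGraph.Adj u v)
    (hz : z ∈ openSegment ℝ (P u) (P v)) (hz' : z ∈ openSegment ℝ (P x) (P y)) :
    ¬ LinearIndependent ℝ ![P v - P u, P y - P x] := by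
  obtain ⟨k, f, hf⟩ := exists_isArc x y
  obtain ⟨l, g, hg⟩ := exists_isArc y x
  obtain ⟨i, rfl⟩ := (hf.exists_apply_eq_iff u).2 hu
  obtain ⟨j, rfl⟩ := (hf.exists_apply_eq_iff v).2 hv
  obtain ⟨e, he⟩ := hf.exists_apply_eq_right
  have hsub := hd.segment_subset_body_reindex hP hf hg (vertex_mem_body_reindex P f i)
    (vertex_mem_body_reindex P f j) (mutuallyVisible_iff.1 huv.2)
  have hedge : openSegment ℝ (reindex P f e) (reindex P f (finRotate k e)) =
      openSegment ℝ (P x) (P y) := by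
    rw [reindex_apply, reindex_apply, he, hf.apply_finRotate_of_eq hd.ne he, openSegment_symm]
  have hli := not_linearIndependent_edge_of_segment_subset_body (hd.isSimple_reindex hP hf) hsub hz
    (hedge ▸ hz')
  rw [reindex_apply, reindex_apply, he, hf.apply_finRotate_of_eq hd.ne he] at hli
  rwa [← neg_sub (P x) (P y), LinearIndependent.pair_neg_right_iff, LinearIndependent.pair_symm_iff]

lemma vertex_notMem_openSegment_of_isChord (hP : P.IsSimple)
    (H : ∀ u v w, P.IsChord u v → w ≠ u → w ≠ v → P w ∉ openSegment ℝ (P u) (P v))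
    (hxy : P.IsChord x y) (w : Fin n) : P w ∉ openSegment ℝ (P x) (P y) := by
  have hne : P x ≠ P y := hP.injective.ne hxy.1.1
  by_cases hx : w = x
  · rwa [hx, left_mem_openSegment_iff]
  by_cases hy : w = y
  · rwa [hy, right_mem_openSegment_iff]
  exact H x y w hxy hx hy

lemma disjoint_of_isUncrossedChord (hP : P.IsSimple)
    (H : ∀ u v w, P.IsChord u v → P w ∉ openSegment ℝ (P u) (P v))
    (h : P.IsUncrossedChord x y) (huv : P.IsChord u v) (hne : s(u, v) ≠ s(x, y)) :
    Disjoint (openSegment ℝ (P u) (P v)) (openSegment ℝ (P x) (P y)) := by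
  refine disjoint_left.2 fun z hz hz' => hne ?_
  have hd := isDiagonal_of_isUncrossedChord hP h
  have hli : ¬ LinearIndependent ℝ ![P v - P u, P y - P x] := by
    rcases btw_and_btw_or_of_not_separated
      (fun hsep => not_adj_of_isUncrossedChord hP h hsep.1 hsep.2 huv.1)
      (fun hsep => not_adj_of_isUncrossedChord hP h hsep.1 hsep.2 huv.1.symm) with
      ⟨hu, hv⟩ | ⟨hu, hv⟩
    · exact not_linearIndependent_of_isDiagonal hP hd hu hv huv.1 hz hz'
    · rw [← neg_sub (P x) (P y), LinearIndependent.pair_neg_right_iff]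
      exact not_linearIndependent_of_isDiagonal hP hd.symm hu hv huv.1 hz
        (by rwa [openSegment_symm])
  have heq := endpoints_eq_of_not_linearIndependent hz hz' hli (H x y u h.1) (H x y v h.1)
    (H u v x huv) (H u v y huv)
  exact Sym2.map.injective hP.injective heq

lemma vertex_notMem_segment_of_isChord (hP : P.IsSimple)
    (H : ∀ u v w, P.IsChord u v → P w ∉ openSegment ℝ (P u) (P v)) (hxy : P.IsChord x y)
    {w : Fin n} (hx : w ≠ x) (hy : w ≠ y) : P w ∉ segment ℝ (P x) (P y) := fun hw => by
  rcases eq_or_eq_or_mem_openSegment_of_mem_segment hw with h | h | h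
  · exact hx (hP.injective h)
  · exact hy (hP.injective h)
  · exact H x y w hxy h

lemma ne_and_ne_of_sbtw {a b c : Fin n} (h : sbtw a b c) : b ≠ a ∧ b ≠ c :=
  ⟨fun e => sbtw_irrefl_left (e ▸ h), fun e => sbtw_irrefl_right (e ▸ h)⟩

lemma openSegment_inter_nonempty_of_separated (hP : P.IsSimple)
    (H : ∀ u v w, P.IsChord u v → P w ∉ openSegment ℝ (P u) (P v)) (hxy : P.IsChord x y)
    (huv : P.IsChord u v) (hu : sbtw x u y) (hv : sbtw y v x)
    (hinter : (segment ℝ (P u) (P v) ∩ segment ℝ (P x) (P y)).Nonempty) :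
    (openSegment ℝ (P u) (P v) ∩ openSegment ℝ (P x) (P y)).Nonempty := by
  have hopen {x y u v : Fin n} {z : Plane} (hxy : P.IsChord x y) (hu : sbtw x u y)
      (hv : sbtw y v x) (hz : z ∈ segment ℝ (P u) (P v)) (hz' : z ∈ segment ℝ (P x) (P y)) :
      z ∈ openSegment ℝ (P u) (P v) := by
    have hu := ne_and_ne_of_sbtw hu
    have hv := ne_and_ne_of_sbtw hv
    refine mem_openSegment_of_ne_left_right ?_ ?_ hz <;> rintro rfl
    · exact vertex_notMem_segment_of_isChord hP H hxy hu.1 hu.2 hz'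
    · exact vertex_notMem_segment_of_isChord hP H hxy hv.2 hv.1 hz'
  obtain ⟨z, hz, hz'⟩ := hinter
  obtain ⟨hy, hx⟩ := sbtw_and_sbtw_comm.1 ⟨hu, hv⟩
  refine ⟨z, hopen hxy hu hv hz hz', ?_⟩
  exact hopen (isChord_symm huv) hx hy hz' (segment_symm ℝ (P u) (P v) ▸ hz)

theorem isUncrossedChord_iff_forall_disjoint (hP : P.IsSimple)
    (H : ∀ u v w, P.IsChord u v → P w ∉ openSegment ℝ (P u) (P v)) :
    P.IsUncrossedChord x y ↔ P.IsChord x y ∧ ∀ u v, P.IsChord u v → s(u, v) ≠ s(x, y) →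
      Disjoint (openSegment ℝ (P u) (P v)) (openSegment ℝ (P x) (P y)) := by
  refine ⟨fun h => ⟨h.1, fun u v => disjoint_of_isUncrossedChord hP H h⟩, ?_⟩
  rintro ⟨hxy, hdisj⟩
  have not_separated {u v : Fin n} (huv : P.IsChord u v)
      (hinter : (segment ℝ (P u) (P v) ∩ segment ℝ (P x) (P y)).Nonempty) :
      ¬ (sbtw x u y ∧ sbtw y v x) := by
    rintro ⟨hu, hv⟩
    have hmeet := openSegment_inter_nonempty_of_separated hP H hxy huv hu hv hinter
    refine not_disjoint_iff_nonempty_inter.2 hmeet (hdisj u v huv fun h => ?_)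
    have hu := ne_and_ne_of_sbtw hu
    rcases Sym2.eq_iff.1 h with h | h
    · exact hu.1 h.1
    · exact hu.2 h.1
  refine ⟨hxy, fun u v huv hc => hc.2.elim (not_separated huv hc.1)
    (not_separated (isChord_symm huv) ?_)⟩
  rw [segment_symm]
  exact hc.1

end Disjoint

section Restriction

variable {n k : ℕ} {P : Polygon Plane n} {a b : Fin n} {f : Fin k → Fin n} {i j : Fin k}

lemma IsDiagonal.adj_reindex_iff (hP : P.IsSimple) (hd : IsDiagonal P a b) (hf : IsArc a b f) :
    (reindex P f).visibilityGraph.Adj i j ↔ P.visibilityGraph.Adj (f i) (f j) := by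
  obtain ⟨l, g, hg⟩ := exists_isArc b a
  change (i ≠ j ∧ (reindex P f).MutuallyVisible (P (f i)) (P (f j))) ↔
    (f i ≠ f j ∧ P.MutuallyVisible (P (f i)) (P (f j)))
  rw [mutuallyVisible_iff, mutuallyVisible_iff, hf.injective.ne_iff]
  exact and_congr_right fun _ => ⟨fun h => h.trans (hd.body_reindex_subset hP hf),
    hd.segment_subset_body_reindex hP hf hg (vertex_mem_body_reindex P f i)
      (vertex_mem_body_reindex P f j)⟩

lemma IsDiagonal.isChord_of_reindex (hP : P.IsSimple) (hd : IsDiagonal P a b) (hf : IsArc a b f)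
    (h : (reindex P f).IsChord i j) : P.IsChord (f i) (f j) :=
  ⟨(hd.adj_reindex_iff hP hf).1 h.1, hd.apply_ne_finRotate hf h.2.1,
    hd.apply_ne_finRotate hf h.2.2⟩

lemma IsDiagonal.isChord_reindex (hP : P.IsSimple) (hd : IsDiagonal P a b) (hf : IsArc a b f)
    (h : P.IsChord (f i) (f j)) (hba : ¬ (f i = b ∧ f j = a)) (hab : ¬ (f j = b ∧ f i = a)) :
    (reindex P f).IsChord i j :=
  ⟨(hd.adj_reindex_iff hP hf).2 h.1, hf.ne_finRotate hd.ne hba h.2.1,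
    hf.ne_finRotate hd.ne hab h.2.2⟩

lemma crosses_reindex_iff (hf : StrictMono f) (u v x y : Fin k) :
    (reindex P f).Crosses u v x y ↔ P.Crosses (f u) (f v) (f x) (f y) := by
  simp only [Crosses, reindex_apply, sbtw_map_iff hf]

lemma not_separated_of_btw {x y u v : Fin n} (hab : a ≠ b) (hx : btw a x b) (hy : btw a y b)
    (hu : btw b u a) (hv : btw b v a) : ¬ (sbtw x u y ∧ sbtw y v x) := by
  rw [Ne, Fin.ext_iff] at hab
  simp only [sbtw_iff_val, btw_iff_val] at *
  lia

lemma isUncrossedChord_reindex_iff (hP : P.IsSimple) (hab : P.IsUncrossedChord a b)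
    (hf : IsArc a b f) (hij : (reindex P f).IsChord i j) :
    (reindex P f).IsUncrossedChord i j ↔ P.IsUncrossedChord (f i) (f j) := by
  have hd := isDiagonal_of_isUncrossedChord hP hab
  refine ⟨fun h => ⟨hd.isChord_of_reindex hP hf hij, fun u v huv hc => ?_⟩, fun h => ⟨hij,
    fun u v huv hc => h.2 _ _ (hd.isChord_of_reindex hP hf huv)
      ((crosses_reindex_iff hf.strictMono _ _ _ _).1 hc)⟩⟩
  have hopposite : ¬ (btw b u a ∧ btw b v a) := fun ⟨hu, hv⟩ =>
    hc.2.elim (not_separated_of_btw hd.ne (hf.btw_apply i) (hf.btw_apply j) hu hv)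
      (not_separated_of_btw hd.ne (hf.btw_apply i) (hf.btw_apply j) hv hu)
  obtain ⟨hu, hv⟩ := (btw_and_btw_or_of_not_separated
    (fun h => not_adj_of_isUncrossedChord hP hab h.1 h.2 huv.1)
    fun h => not_adj_of_isUncrossedChord hP hab h.1 h.2 huv.1.symm).resolve_right hopposite
  obtain ⟨u, rfl⟩ := (hf.exists_apply_eq_iff u).2 hu
  obtain ⟨v, rfl⟩ := (hf.exists_apply_eq_iff v).2 hv
  refine h.2 u v (hd.isChord_reindex hP hf huv ?_ ?_)
    ((crosses_reindex_iff hf.strictMono _ _ _ _).2 hc)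
  · rintro ⟨hub, hva⟩
    exact hopposite ⟨hub ▸ btw_refl_left _ _, hva ▸ btw_refl_right _ _⟩
  · rintro ⟨hvb, hua⟩
    exact hopposite ⟨hua ▸ btw_refl_right _ _, hvb ▸ btw_refl_left _ _⟩

end Restriction

/-! ### Subpolygons and pieces -/

section Components

variable {V : Type*} {G : SimpleGraph V} {k : ℕ} {f : Fin k → V} {a b i : Fin k}

lemma btw_iff_sbtw_or (hab : a ≠ b) : btw a i b ↔ sbtw a i b ∨ i = a ∨ i = b := by
  refine ⟨fun h => ?_, ?_⟩
  · by_contra! hi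
    exact ((sbtw_or_sbtw hab hi.2.1 hi.2.2).resolve_left hi.1).not_btw h
  · rintro (h | rfl | rfl)
    · exact h.btw
    · exact btw_refl_left _ _
    · exact btw_refl_right _ _

lemma image_supp_union_eq_image_btw (hf : Function.Injective f)
    (hadj : ∀ i, G.Adj (f i) (f (finRotate k i))) (hab : a ≠ b)
    (hno : ∀ u v, sbtw a u b → sbtw b v a → ¬ G.Adj (f u) (f v))
    {z : ↥(range f \ {f a, f b})} (hi : sbtw a i b) (hz : f i = z) :
    Subtype.val '' ((G.induce (range f \ {f a, f b})).connectedComponentMk z).supp ∪ {f a, f b} =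
      f '' {i | btw a i b} := by
  have hunion : {i | btw a i b} = {i | sbtw a i b} ∪ {a, b} := by
    ext i
    simp only [btw_iff_sbtw_or hab, mem_ofPred_eq, mem_union, mem_insert_iff, mem_singleton_iff]
  rw [hunion, image_union, image_pair]
  congr 1
  ext w
  constructor
  · rintro ⟨w, hw, rfl⟩
    obtain ⟨j, hj, hj'⟩ := exists_sbtw_of_reachable hab hno
      (SimpleGraph.ConnectedComponent.exact hw).symm ⟨i, hz, hi⟩
    exact ⟨j, hj', hj⟩
  · rintro ⟨j, hj, rfl⟩
    obtain ⟨z, _⟩ := z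
    obtain rfl := hz
    exact ⟨⟨f j, mem_range_diff_of_sbtw hf hj⟩, SimpleGraph.ConnectedComponent.sound
      (reachable_of_sbtw hadj (fun _ => mem_range_diff_of_sbtw hf) hj hi), rfl⟩

lemma image_supp_union_eq_of_preconnected {s t : Set V} (hts : t ⊆ s)
    (hpre : (G.induce (s \ t)).Preconnected) (C : (G.induce (s \ t)).ConnectedComponent) :
    Subtype.val '' C.supp ∪ t = s := by
  obtain ⟨z, rfl⟩ := C.exists_rep
  have hsupp : ((G.induce (s \ t)).connectedComponentMk z).supp = univ :=
    eq_univ_of_forall fun w => SimpleGraph.ConnectedComponent.sound (hpre w z)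
  change Subtype.val '' ((G.induce (s \ t)).connectedComponentMk z).supp ∪ t = s
  rw [hsupp, image_univ, Subtype.range_coe, sdiff_union_of_subset hts]

end Components

variable {n k l : ℕ} {P : Polygon Plane n} {f : Fin k → Fin n} {g : Fin l → Fin k} {a b : Fin k}

/-- The polygon on the vertices of `P` selected by `f` is simple and inherits its visibility graph
and its uncrossed chords from `P`. This is what successive division along uncrossed chords
preserves. -/
structure IsFaithful (P : Polygon Plane n) (f : Fin k → Fin n) : Prop where
  strictMono : StrictMono f
  isSimple : (reindex P f).IsSimple
  adj_iff : ∀ i j, (reindex P f).visibilityGraph.Adj i j ↔ P.visibilityGraph.Adj (f i) (f j)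
  isUncrossedChord_iff : ∀ i j, (reindex P f).IsChord i j →
    ((reindex P f).IsUncrossedChord i j ↔ P.IsUncrossedChord (f i) (f j))

lemma isFaithful_of_surjective (hP : P.IsSimple) (hf : StrictMono f)
    (hsurj : Function.Surjective f) : IsFaithful P f := by
  obtain rfl : k = n := Fin.equiv_iff_eq.1 ⟨.ofBijective f ⟨hf.injective, hsurj⟩⟩
  obtain rfl : f = id := funext fun i =>
    congrArg (fun e : Fin k ≃o Fin k => e i)
      (Subsingleton.elim (hf.orderIsoOfSurjective f hsurj) (OrderIso.refl _))
  exact ⟨hf, hP, fun _ _ => Iff.rfl, fun _ _ _ => Iff.rfl⟩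

lemma IsFaithful.comp (h : IsFaithful P f) (hab : (reindex P f).IsUncrossedChord a b)
    (hg : IsArc a b g) : IsFaithful P (f ∘ g) := by
  have hd := isDiagonal_of_isUncrossedChord h.isSimple hab
  exact ⟨h.strictMono.comp hg.strictMono, (hd.isSimple_reindex h.isSimple hg :),
    fun i j => (hd.adj_reindex_iff h.isSimple hg).trans (h.adj_iff _ _),
    fun i j hij => (isUncrossedChord_reindex_iff h.isSimple hab hg hij).trans
      (h.isUncrossedChord_iff _ _ (hd.isChord_of_reindex h.isSimple hg hij))⟩

lemma IsFaithful.injective (h : IsFaithful P f) : Function.Injective f := h.strictMono.injective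

lemma IsFaithful.adj_finRotate (h : IsFaithful P f) (i : Fin k) :
    P.visibilityGraph.Adj (f i) (f (finRotate k i)) :=
  (h.adj_iff _ _).1 (SimplePolygon.adj_finRotate h.isSimple i)

lemma IsFaithful.preconnected_iff (h : IsFaithful P f)
    (hadj : P.visibilityGraph.Adj (f a) (f b)) :
    (P.visibilityGraph.induce (range f \ {f a, f b})).Preconnected ↔
      ¬ (reindex P f).IsUncrossedChord a b := by
  have hadj' := (h.adj_iff a b).2 hadj
  rw [preconnected_induce_range_diff_iff h.injective h.adj_finRotate hadj'.1,
    isUncrossedChord_iff_not_linked h.isSimple hadj', not_not]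
  simp only [h.adj_iff]

lemma IsFaithful.isBottleneckPair (hP : P.IsSimple) (h : IsFaithful P f)
    (hab : (reindex P f).IsUncrossedChord a b) :
    P.visibilityGraph.IsBottleneckPair (f a) (f b) :=
  (isBottleneckPair_iff_isUncrossedChord hP _ _).2 ((h.isUncrossedChord_iff a b hab.1).1 hab)

lemma isReduced_iff_forall_not_isUncrossedChord :
    P.IsReduced ↔ ∀ x y, ¬ P.IsUncrossedChord x y := by
  simp only [Polygon.IsReduced, IsUncrossedChord, not_and, not_forall, not_not, exists_prop]

lemma IsFaithful.isReduced_iff (hP : P.IsSimple) (h : IsFaithful P f) :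
    (reindex P f).IsReduced ↔ ∀ x y, P.visibilityGraph.IsBottleneckPair x y → x ∈ range f →
      y ∈ range f → (P.visibilityGraph.induce (range f \ {x, y})).Preconnected := by
  rw [isReduced_iff_forall_not_isUncrossedChord]
  constructor
  · rintro hred _ _ hab ⟨a, rfl⟩ ⟨b, rfl⟩
    exact (h.preconnected_iff hab.1).2 (hred a b)
  · intro hpre a b hab
    have hbot := h.isBottleneckPair hP hab
    exact (h.preconnected_iff hbot.1).1 (hpre _ _ hbot ⟨a, rfl⟩ ⟨b, rfl⟩) hab

lemma IsFaithful.not_adj (h : IsFaithful P f) (hab : (reindex P f).IsUncrossedChord a b)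
    (u v : Fin k) (hu : sbtw a u b) (hv : sbtw b v a) : ¬ P.visibilityGraph.Adj (f u) (f v) :=
  fun huv => not_adj_of_isUncrossedChord h.isSimple hab hu hv ((h.adj_iff u v).2 huv)

lemma IsFaithful.image_supp_union_eq_image_btw (h : IsFaithful P f)
    (hab : (reindex P f).IsUncrossedChord a b) {z : ↥(range f \ {f a, f b})} {i : Fin k}
    (hi : sbtw a i b) (hz : f i = z) :
    Subtype.val '' ((P.visibilityGraph.induce _).connectedComponentMk z).supp ∪ {f a, f b} =
      f '' {i | btw a i b} :=
  SimplePolygon.image_supp_union_eq_image_btw h.injective h.adj_finRotate hab.1.1.1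
    (h.not_adj hab) hi hz

lemma IsFaithful.isPiece_image_btw (hP : P.IsSimple) (h : IsFaithful P f)
    (hf : P.visibilityGraph.IsPiece (range f)) (hab : (reindex P f).IsUncrossedChord a b) :
    P.visibilityGraph.IsPiece (f '' {i | btw a i b}) := by
  have hfirst := sbtw_finRotate hab.1.1.1 hab.1.2.1
  rw [← h.image_supp_union_eq_image_btw hab (z := ⟨_, mem_range_diff_of_sbtw h.injective hfirst⟩)
    hfirst rfl]
  exact .cut _ _ _ _ hf (h.isBottleneckPair hP hab) ⟨a, rfl⟩ ⟨b, rfl⟩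

lemma IsFaithful.image_supp_union_eq (h : IsFaithful P f)
    (hadj : P.visibilityGraph.Adj (f a) (f b))
    (C : (P.visibilityGraph.induce (range f \ {f a, f b})).ConnectedComponent) :
    Subtype.val '' C.supp ∪ {f a, f b} = range f ∨ ((reindex P f).IsUncrossedChord a b ∧
      (Subtype.val '' C.supp ∪ {f a, f b} = f '' {i | btw a i b} ∨
        Subtype.val '' C.supp ∪ {f a, f b} = f '' {i | btw b i a})) := by
  by_cases hab : (reindex P f).IsUncrossedChord a b
  · refine Or.inr ⟨hab, ?_⟩
    obtain ⟨z, rfl⟩ := C.exists_rep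
    obtain ⟨i, hz, hi | hi⟩ := exists_sbtw_of_mem_range_diff hab.1.1.1 z.2
    · exact Or.inl (h.image_supp_union_eq_image_btw hab hi hz)
    · right
      revert z
      rw [pair_comm]
      exact fun z hz => h.image_supp_union_eq_image_btw (isUncrossedChord_symm hab) hi hz
  · exact Or.inl (image_supp_union_eq_of_preconnected
      (pair_subset (mem_range_self a) (mem_range_self b)) ((h.preconnected_iff hadj).2 hab) C)

section Subpolygons

variable {S T : Finset (Fin n)} {a b : Fin S.card}

lemma coe_eq_image_btw
    (hT : ∀ w, w ∈ T ↔ w ∈ S ∧ btw (S.orderEmbOfFin rfl a) w (S.orderEmbOfFin rfl b)) :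
    (T : Set (Fin n)) = S.orderEmbOfFin rfl '' {i | btw a i b} := by
  have hbtw (i : Fin S.card) : btw (S.orderEmbOfFin rfl a) (S.orderEmbOfFin rfl i)
      (S.orderEmbOfFin rfl b) ↔ btw a i b := by
    rw [btw_iff_not_sbtw, btw_iff_not_sbtw, sbtw_map_iff (S.orderEmbOfFin rfl).strictMono]
  ext w
  rw [Finset.mem_coe, hT, ← Finset.mem_coe, ← Finset.range_orderEmbOfFin S rfl]
  constructor
  · rintro ⟨⟨i, rfl⟩, hi⟩
    exact ⟨i, (hbtw i).1 hi, rfl⟩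
  · rintro ⟨i, hi, rfl⟩
    exact ⟨⟨i, rfl⟩, (hbtw i).2 hi⟩

lemma exists_isArc_comp_eq_orderEmbOfFin
    (hT : ∀ w, w ∈ T ↔ w ∈ S ∧ btw (S.orderEmbOfFin rfl a) w (S.orderEmbOfFin rfl b)) :
    ∃ g : Fin T.card → Fin S.card, IsArc a b g ∧
      S.orderEmbOfFin rfl ∘ g = T.orderEmbOfFin rfl := by
  have hrange : range (T.orderEmbOfFin rfl) = S.orderEmbOfFin rfl '' {i | btw a i b} := by
    rw [Finset.range_orderEmbOfFin, coe_eq_image_btw hT]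
  choose g hbtw hg using fun i => hrange.subset ⟨i, rfl⟩
  refine ⟨g, ⟨fun i j hij => ?_, fun w => ⟨?_, fun hw => ?_⟩⟩, funext hg⟩
  · rwa [← (S.orderEmbOfFin rfl).lt_iff_lt, hg, hg, OrderEmbedding.lt_iff_lt]
  · rintro ⟨i, rfl⟩
    exact hbtw i
  · obtain ⟨i, hi⟩ := hrange.superset ⟨w, hw, rfl⟩
    exact ⟨i, (S.orderEmbOfFin rfl).injective ((hg i).trans hi)⟩

lemma isFaithful_of_isSubpolygon (hP : P.IsSimple) (hS : P.IsSubpolygon S) :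
    IsFaithful P (S.orderEmbOfFin rfl) := by
  induction hS with
  | whole =>
    refine isFaithful_of_surjective hP (OrderEmbedding.strictMono _) (range_eq_univ.1 ?_)
    rw [Finset.range_orderEmbOfFin, Finset.coe_univ]
  | divide S T a b _ hab hT ih =>
    obtain ⟨g, hg, hgT⟩ := exists_isArc_comp_eq_orderEmbOfFin hT
    exact hgT ▸ ih.comp hab hg

lemma isPiece_of_isSubpolygon (hP : P.IsSimple) (hS : P.IsSubpolygon S) :
    P.visibilityGraph.IsPiece S := by
  induction hS with
  | whole =>
    rw [Finset.coe_univ]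
    exact .whole
  | divide S T a b hS hab hT ih =>
    rw [coe_eq_image_btw hT]
    rw [← Finset.range_orderEmbOfFin S rfl] at ih
    exact (isFaithful_of_isSubpolygon hP hS).isPiece_image_btw hP ih hab

lemma exists_isSubpolygon_of_image_btw (hS : P.IsSubpolygon S)
    (hab : (P.sub S).IsUncrossedChord a b) :
    ∃ T : Finset (Fin n), P.IsSubpolygon T ∧ (T : Set (Fin n)) =
      S.orderEmbOfFin rfl '' {i | btw a i b} := by
  classical
  have hT (w : Fin n) := Finset.mem_filter
    (p := fun w => btw (S.orderEmbOfFin rfl a) w (S.orderEmbOfFin rfl b)) (s := S) (a := w)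
  exact ⟨_, hS.divide _ _ a b hab hT, coe_eq_image_btw hT⟩

lemma exists_isSubpolygon_of_isPiece (hP : P.IsSimple) {U : Set (Fin n)}
    (hU : P.visibilityGraph.IsPiece U) :
    ∃ S : Finset (Fin n), P.IsSubpolygon S ∧ (S : Set (Fin n)) = U := by
  induction hU with
  | whole => exact ⟨Finset.univ, .whole, Finset.coe_univ⟩
  | cut U x y C _ hxy hx hy ih =>
    obtain ⟨S, hS, hSU⟩ := ih
    obtain rfl := (Finset.range_orderEmbOfFin S rfl).trans hSU
    obtain ⟨a, rfl⟩ := hx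
    obtain ⟨b, rfl⟩ := hy
    rcases (isFaithful_of_isSubpolygon hP hS).image_supp_union_eq hxy.1 C with
      hC | ⟨hab, hC | hC⟩ <;> rw [hC]
    · exact ⟨S, hS, hSU⟩
    · exact exists_isSubpolygon_of_image_btw hS hab
    · exact exists_isSubpolygon_of_image_btw hS (isUncrossedChord_symm hab)

lemma isReduced_sub_iff (hP : P.IsSimple) (hS : P.IsSubpolygon S) :
    (P.sub S).IsReduced ↔ ∀ x y, P.visibilityGraph.IsBottleneckPair x y →
      x ∈ (S : Set (Fin n)) → y ∈ (S : Set (Fin n)) →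
        (P.visibilityGraph.induce ((S : Set (Fin n)) \ {x, y})).Preconnected := by
  rw [← Finset.range_orderEmbOfFin S rfl]
  exact (isFaithful_of_isSubpolygon hP hS).isReduced_iff hP

lemma isVisibilityGraphOfSub_induce (hP : P.IsSimple) (hS : P.IsSubpolygon S) :
    P.IsVisibilityGraphOfSub S ((⊤ : P.visibilityGraph.Subgraph).induce S) := by
  refine ⟨rfl, fun a b => .trans ?_ ((isFaithful_of_isSubpolygon hP hS).adj_iff a b).symm⟩
  have hmem (i : Fin S.card) : S.orderEmbOfFin rfl i ∈ (S : Set (Fin n)) :=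
    Finset.orderEmbOfFin_mem S rfl i
  simp only [SimpleGraph.Subgraph.induce_adj, SimpleGraph.Subgraph.top_adj, hmem, true_and]

end Subpolygons

end SimplePolygon

theorem lemma3 {n : ℕ} (P : Polygon Plane n) (hP : P.IsSimple) :
    -- bottleneck pairs are exactly the chords that no chord crosses
    (∀ x y : Fin n, P.visibilityGraph.IsBottleneckPair x y ↔ P.IsUncrossedChord x y) ∧
    -- if no chord passes through a third vertex, crossing just means that the open segments meet
    ((∀ u v w : Fin n, P.IsChord u v → w ≠ u → w ≠ v → P w ∉ openSegment ℝ (P u) (P v)) →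
      ∀ x y : Fin n, P.visibilityGraph.IsBottleneckPair x y ↔
        P.IsChord x y ∧ ∀ u v : Fin n, P.IsChord u v → s(u, v) ≠ s(x, y) →
          Disjoint (openSegment ℝ (P u) (P v)) (openSegment ℝ (P x) (P y))) ∧
    -- the reduced subpolygons are simple polygons
    (∀ S : Finset (Fin n), P.IsReducedSubpolygon S → (P.sub S).IsSimple) ∧
    -- each reduced subgraph is the visibility graph of a reduced subpolygon
    (∀ H : P.visibilityGraph.Subgraph, P.visibilityGraph.IsReducedSubgraph H →
      ∃ S : Finset (Fin n), P.IsReducedSubpolygon S ∧ P.IsVisibilityGraphOfSub S H) ∧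
    -- each reduced subpolygon has a reduced subgraph as its visibility graph
    (∀ S : Finset (Fin n), P.IsReducedSubpolygon S →
      ∃ H : P.visibilityGraph.Subgraph,
        P.visibilityGraph.IsReducedSubgraph H ∧ P.IsVisibilityGraphOfSub S H) := by
  refine ⟨SimplePolygon.isBottleneckPair_iff_isUncrossedChord hP, fun H x y => ?_,
    fun S hS => (SimplePolygon.isFaithful_of_isSubpolygon hP hS.1).isSimple, ?_, fun S hS => ?_⟩
  · rw [SimplePolygon.isBottleneckPair_iff_isUncrossedChord hP]
    exact SimplePolygon.isUncrossedChord_iff_forall_disjoint hP fun u v w huv =>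
      SimplePolygon.vertex_notMem_openSegment_of_isChord hP H huv w
  · rintro _ ⟨U, hU, hpre, rfl⟩
    obtain ⟨S, hS, rfl⟩ := SimplePolygon.exists_isSubpolygon_of_isPiece hP hU
    exact ⟨S, ⟨hS, (SimplePolygon.isReduced_sub_iff hP hS).2 hpre⟩,
      SimplePolygon.isVisibilityGraphOfSub_induce hP hS⟩
  · exact ⟨_, ⟨S, SimplePolygon.isPiece_of_isSubpolygon hP hS.1,
      (SimplePolygon.isReduced_sub_iff hP hS.1).1 hS.2, rfl⟩,
      SimplePolygon.isVisibilityGraphOfSub_induce hP hS.1⟩
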